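/- An mm-space is a complete separable metric space $X$ with metric $d_X$ and a Borel probability measure $\mu_X$ of full support; $\mathrm{Aut}(X)$ is the group of isometries of $X$ that preserve $\mu_X$, with the topology of convergence in measure (equivalently, of the Ky Fan metric). Consider pairs $(X,G)$ of an mm-space $X$ and a closed subgroup $G\subset\mathrm{Aut}(X)$. Two pairs $(X,G)$ and $(Y,H)$ are equivariantly mm-isomorphic if there is a bijective isometry $\varphi:X\to Y$ with $\varphi_*\mu_X=\mu_Y$ that is equivariant for some group isomorphism $G\to H$. Let $\mathcal{X}_{\rm eq}$ be the set of equivariant mm-isomorphism classes. For a coupling $\pi\in\Pi(X,Y)$ of $\mu_X$ and $\mu_Y$, for $g\in G$, $h\in H$ and $S\subset X\times Y$, put $$d^S(g,h):=\sup_{(x_1,y_1),(x_2,y_2)\in S}|d_X(g(x_1),x_2)-d_Y(h(y_1),y_2)|\in[0,+\infty],\qquad d^\emptyset(g,h):=0,$$ $$d^\pi(g,h):=\inf_S\max\{1-\pi(S),\,d^S(g,h)\},$$ where $S$ runs over all closed subsets of $\mathrm{supp}\,\pi$. Let $$\square^\pi((X,G),(Y,H)):=\max\Big\{\sup_{g\in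 G}\inf_{h\in H}d^\pi(g,h),\ \sup_{h\in H}\inf_{g\in G}d^\pi(g,h)\Big\}$$ be the Hausdorff distance between $G$ and $H$ with respect to $d^\pi$, and define the equivariant box distance by $$\square((X,G),(Y,H)):=\inf_{\pi\in\Pi(X,Y)}\square^\pi((X,G),(Y,H)).$$ This depends only on the classes of $(X,G)$ and $(Y,H)$. Corollary. $\mathcal{X}_{\rm eq}$ is complete with respect to the equivariant box metric; that is, $\square$ is a metric on $\mathcal{X}_{\rm eq}$, and the metric space $(\mathcal{X}_{\rm eq},\square)$ is complete. -/

import Mathlib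

open MeasureTheory Filter Topology Set
open scoped ENNReal

universe u

/-- An mm-space: a complete separable metric space with a Borel probability measure of full
support. -/
structure MMSpace : Type (u + 1) where
  carrier : Type u
  [metricSpace : MetricSpace carrier]
  [completeSpace : CompleteSpace carrier]
  [separableSpace : TopologicalSpace.SeparableSpace carrier]
  [measurableSpace : MeasurableSpace carrier]
  [borelSpace : BorelSpace carrier]
  μ : Measure carrier
  [isProbabilityMeasure : IsProbabilityMeasure μ]
  [isOpenPosMeasure : μ.IsOpenPosMeasure]

namespace MMSpace

instance : CoeSort MMSpace.{u} (Type u) := ⟨MMSpace.carrier⟩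

attribute [instance] metricSpace completeSpace separableSpace measurableSpace borelSpace
  isProbabilityMeasure isOpenPosMeasure

/-- `Aut(X)`: the group of measure preserving isometries of `X`. -/
def Aut (X : MMSpace.{u}) : Subgroup (X ≃ᵢ X) where
  carrier := {g | MeasurePreserving g X.μ X.μ}
  mul_mem' := fun {g h} hg hh => by
    have hg' : MeasurePreserving g X.μ X.μ := hg
    exact hg'.comp hh
  one_mem' := MeasurePreserving.id X.μ
  inv_mem' := fun {g} hg => by
    have hg' : MeasurePreserving g.toHomeomorph.toMeasurableEquiv X.μ X.μ := hg
    exact hg'.symm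

/-- `G` is closed in `Aut(X)` for convergence in measure (i.e. for the Ky Fan metric, which
metrizes convergence in measure, so that sequences suffice). -/
def IsClosedSubgroup (X : MMSpace.{u}) (G : Subgroup X.Aut) : Prop :=
  ∀ (g : ℕ → X.Aut) (h : X.Aut), (∀ n, g n ∈ G) →
    TendstoInMeasure X.μ (fun n x => (g n).1 x) atTop (fun x => h.1 x) → h ∈ G

/-- `Π(X, Y)`: the couplings of `μ_X` and `μ_Y`. -/
def Couplings (X Y : MMSpace.{u}) : Set (Measure (X × Y)) :=
  {π | π.map Prod.fst = X.μ ∧ π.map Prod.snd = Y.μ}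

/-- `d^S(g, h) = sup |d_X(g x₁, x₂) - d_Y(h y₁, y₂)|` over `(x₁, y₁), (x₂, y₂) ∈ S`, an extended
nonnegative real, which is `0` for `S = ∅`. -/
noncomputable def dS {X Y : MMSpace.{u}} (S : Set (X × Y)) (g : X → X) (h : Y → Y) : ℝ≥0∞ :=
  ⨆ p ∈ S, ⨆ q ∈ S, ENNReal.ofReal |dist (g p.1) q.1 - dist (h p.2) q.2|

/-- `d^π(g, h) = inf max {1 - π(S), d^S(g, h)}` over the closed subsets `S` of `supp π`. -/
noncomputable def dπ {X Y : MMSpace.{u}} (π : Measure (X × Y)) (g : X → X) (h : Y → Y) : ℝ≥0∞ :=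
  ⨅ (S : Set (X × Y)) (_ : IsClosed S) (_ : S ⊆ π.support), max (1 - π S) (dS S g h)

end MMSpace

/-- A pair `(X, G)` of an mm-space and a closed subgroup of `Aut(X)`. -/
structure EqMMSpace : Type (u + 1) where
  X : MMSpace.{u}
  G : Subgroup X.Aut
  closed : X.IsClosedSubgroup G

namespace EqMMSpace

/-- Equivariant mm-isomorphism: a measure preserving isometry from `X` onto `Y` that is equivariant
for some group isomorphism from `G` to `H`. -/
def Iso (A B : EqMMSpace.{u}) : Prop :=
  ∃ φ : A.X ≃ᵢ B.X, MeasurePreserving φ A.X.μ B.X.μ ∧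
    ∃ ρ : A.G ≃* B.G, ∀ (g : A.G) (x : A.X), φ (g.1.1 x) = (ρ g).1.1 (φ x)

/-- The Hausdorff distance between `G` and `H` with respect to `d^π`. -/
noncomputable def boxWith (A B : EqMMSpace.{u}) (π : Measure (A.X × B.X)) : ℝ≥0∞ :=
  max (⨆ g : A.G, ⨅ h : B.G, MMSpace.dπ π g.1.1 h.1.1)
    (⨆ h : B.G, ⨅ g : A.G, MMSpace.dπ π g.1.1 h.1.1)

/-- The equivariant box distance between `(X, G)` and `(Y, H)`. -/
noncomputable def box (A B : EqMMSpace.{u}) : ℝ≥0∞ :=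
  ⨅ π ∈ MMSpace.Couplings A.X B.X, boxWith A B π

theorem Iso.refl (A : EqMMSpace.{u}) : Iso A A :=
  ⟨IsometryEquiv.refl _, MeasurePreserving.id _, MulEquiv.refl _, fun _ _ => rfl⟩

theorem Iso.symm {A B : EqMMSpace.{u}} : Iso A B → Iso B A := by
  rintro ⟨φ, hφ, ρ, h⟩
  refine ⟨φ.symm, ?_, ρ.symm, fun g x => ?_⟩
  · have hφ' : MeasurePreserving φ.toHomeomorph.toMeasurableEquiv A.X.μ B.X.μ := hφ
    exact hφ'.symm
  · apply φ.injective
    rw [h]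
    simp

theorem Iso.trans {A B C : EqMMSpace.{u}} : Iso A B → Iso B C → Iso A C := by
  rintro ⟨φ, hφ, ρ, h⟩ ⟨ψ, hψ, σ, k⟩
  refine ⟨φ.trans ψ, hψ.comp hφ, ρ.trans σ, fun g x => ?_⟩
  simp [h, k]

instance setoid : Setoid EqMMSpace.{u} := ⟨Iso, Iso.refl, Iso.symm, Iso.trans⟩

theorem box_le_of_iso {A A' B B' : EqMMSpace.{u}} (hA : Iso A A') (hB : Iso B B') :
    box A B ≤ box A' B' := by
  obtain ⟨φ, hφ, ρ, hρ⟩ := hA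
  obtain ⟨ψ, hψ, σ, hσ⟩ := hB
  let e : A.X × B.X ≃ₜ A'.X × B'.X := φ.toHomeomorph.prodCongr ψ.toHomeomorph
  have he : ∀ p, e p = (φ p.1, ψ p.2) := fun _ => rfl
  have hes : ∀ p, e.symm p = (φ.symm p.1, ψ.symm p.2) := fun _ => rfl
  have hem : Measurable e.symm := e.symm.continuous.measurable
  refine le_iInf₂ fun π hπ => ?_
  have hc : π.map e.symm ∈ MMSpace.Couplings A.X B.X := by
    have hφ' : MeasurePreserving φ.toHomeomorph.toMeasurableEquiv A.X.μ A'.X.μ := hφ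
    have hψ' : MeasurePreserving ψ.toHomeomorph.toMeasurableEquiv B.X.μ B'.X.μ := hψ
    constructor
    · rw [Measure.map_map measurable_fst hem, ← hφ'.symm.map_eq, ← hπ.1,
        Measure.map_map (MeasurableEquiv.measurable _) measurable_fst]
      rfl
    · rw [Measure.map_map measurable_snd hem, ← hψ'.symm.map_eq, ← hπ.2,
        Measure.map_map (MeasurableEquiv.measurable _) measurable_snd]
      rfl
  have key : ∀ (g : A.G) (h : B.G),
      MMSpace.dπ (π.map e.symm) g.1.1 h.1.1 ≤ MMSpace.dπ π (ρ g).1.1 (σ h).1.1 := by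
    intro g h
    refine le_iInf fun S => le_iInf fun hS => le_iInf fun hSπ => ?_
    refine iInf_le_of_le (e ⁻¹' S) (iInf_le_of_le (hS.preimage e.continuous)
      (iInf_le_of_le ?_ (max_le_max ?_ ?_)))
    · intro p hp
      rw [Measure.mem_support_iff_forall]
      intro U hU
      have h1 : e.symm ⁻¹' U ∈ 𝓝 (e p) :=
        e.symm.continuous.continuousAt.preimage_mem_nhds (by simpa using hU)
      have h2 := (Measure.mem_support_iff_forall (e p)).1 (hSπ hp) _ h1
      exact h2.trans_le (Measure.le_map_apply hem.aemeasurable U)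
    · rw [Measure.map_apply hem (hS.preimage e.continuous).measurableSet, ← preimage_comp]
      simp
    · refine iSup₂_le fun p hp => iSup₂_le fun q hq => ?_
      refine le_trans ?_ (le_iSup₂_of_le (e p) hp (le_iSup₂_of_le (e q) hq le_rfl))
      simp only [he]
      rw [← hρ, ← hσ, φ.dist_eq, ψ.dist_eq]
  refine (iInf₂_le _ hc).trans (max_le_max ?_ ?_)
  · refine iSup_le fun g => le_iSup_of_le (ρ g) (le_iInf fun h => iInf_le_of_le (σ.symm h) ?_)
    simpa using key g (σ.symm h)
  · refine iSup_le fun h => le_iSup_of_le (σ h) (le_iInf fun g => iInf_le_of_le (ρ.symm g) ?_)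
    simpa using key (ρ.symm g) h

end EqMMSpace

/-- `𝒳_eq`: the equivariant mm-isomorphism classes of pairs `(X, G)`. -/
def XEq : Type (u + 1) := Quotient EqMMSpace.setoid.{u}

/-- The equivariant box distance on `𝒳_eq`. -/
noncomputable def XEq.box : XEq.{u} → XEq.{u} → ℝ≥0∞ :=
  Quotient.lift₂ EqMMSpace.box fun _ _ _ _ hA hB =>
    le_antisymm (EqMMSpace.box_le_of_iso hA hB)
      (EqMMSpace.box_le_of_iso (EqMMSpace.Iso.symm hA) (EqMMSpace.Iso.symm hB))

/-! A coupling is replaced by a probability space with two maps `a`, `b` of the right laws, and an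
isometry `g` by its kernel `dist (g (a ω)) (a ω')`; `IsNear` compares kernels off a small
exceptional set. Closeness adds up once couplings are glued along a common marginal, whence the
triangle inequality.

A kernel sees `g (a ω)` only through its distances to points `a ω'`. Balls have positive measure,
invariant under automorphisms, so `g (a ω)` is typically near some `a ω'` with `ω'` not exceptional
(`exists_mem_dist_lt`). This drives all the arguments on composition, conjugation and limits.

If the distance is zero, the partners of the identity show that the metrics nearly agree along
couplings of vanishing error. Their marginals are fixed, hence tight, and along an ultrafilter they
concentrate on the graph of a measure preserving isometry `φ` (`exists_isometryEquiv_of_isNear_id`).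
The `φ`-conjugates of elements of one group are limits in measure of elements of the other, which is
closed (`exists_conj_mem`).

For completeness, take consecutive distances below `(1 / 2) ^ n` and realize near-optimal couplings
together as a Markov chain on the product of the spaces. The pulled-back metrics converge uniformly
off sets of small measure, and their limit defines the space `Z` (`exists_limit`). Along successive
partners in the groups the kernels converge in the same way, to the kernel of an automorphism of `Z`
(`exists_aut_limit`). The automorphisms approximated by elements of late groups form a closed
subgroup, and `Z` with this group is the limit. -/

/-- A conditional law that depends on the past only through `f` gives the prescribed joint law with
`f`. This identifies the second marginal in both gluing constructions. -/
theorem MeasureTheory.Measure.map_compProd_comap {α β γ : Type*} [MeasurableSpace α]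
    [MeasurableSpace β] [MeasurableSpace γ] (ν : Measure α) [SFinite ν] {f : α → β}
    (hf : Measurable f) (κ : ProbabilityTheory.Kernel β γ) [ProbabilityTheory.IsSFiniteKernel κ] :
    (ν.compProd (κ.comap f hf)).map (fun p => (f p.1, p.2)) = (ν.map f).compProd κ := by
  ext s hs
  have hm : Measurable fun p : α × γ => (f p.1, p.2) := by fun_prop
  rw [Measure.map_apply hm hs, Measure.compProd_apply (hm hs), Measure.compProd_apply hs,
    lintegral_map (ProbabilityTheory.Kernel.measurable_kernel_prodMk_left hs) hf]
  rfl

/-! ### Closeness of self-maps along a pair of maps -/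

section IsNear

variable {Ω Ω' X Y Z : Type*} [MeasurableSpace Ω] [MeasurableSpace Ω']
  [PseudoMetricSpace X] [PseudoMetricSpace Y] [PseudoMetricSpace Z]

/-- The self-maps `g` and `h` are `ε`-close along the maps `a` and `b`, up to an exceptional set of
measure at most `ε`. -/
def IsNear (P : Measure Ω) (a : Ω → X) (b : Ω → Y) (g : X → X) (h : Y → Y) (ε : ℝ) : Prop :=
  ∃ E : Set Ω, P.real Eᶜ ≤ ε ∧ ∀ ω ∈ E, ∀ ω' ∈ E,
    |dist (g (a ω)) (a ω') - dist (h (b ω)) (b ω')| ≤ ε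

variable {P : Measure Ω} {a : Ω → X} {b : Ω → Y} {c : Ω → Z} {g g' : X → X} {h h' : Y → Y}
  {k : Z → Z} {ε ε' : ℝ}

theorem IsNear.nonneg (H : IsNear P a b g h ε) : 0 ≤ ε := by
  obtain ⟨E, hE, -⟩ := H
  exact measureReal_nonneg.trans hE

theorem IsNear.mono (H : IsNear P a b g h ε) (hε : ε ≤ ε') : IsNear P a b g h ε' := by
  obtain ⟨E, hE, H⟩ := H
  exact ⟨E, hE.trans hε, fun ω hω ω' hω' => (H ω hω ω' hω').trans hε⟩

theorem IsNear.symm (H : IsNear P a b g h ε) : IsNear P b a h g ε := by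
  obtain ⟨E, hE, H⟩ := H
  exact ⟨E, hE, fun ω hω ω' hω' => by rw [abs_sub_comm]; exact H ω hω ω' hω'⟩

theorem IsNear.trans [IsFiniteMeasure P] (H : IsNear P a b g h ε) (H' : IsNear P b c h k ε') :
    IsNear P a c g k (ε + ε') := by
  obtain ⟨E, hE, H⟩ := H
  obtain ⟨F, hF, H'⟩ := H'
  refine ⟨E ∩ F, ?_, fun ω hω ω' hω' => ?_⟩
  · rw [compl_inter]
    exact (measureReal_union_le _ _).trans (add_le_add hE hF)
  · exact (abs_sub_le _ _ _).trans (add_le_add (H ω hω.1 ω' hω'.1) (H' ω hω.2 ω' hω'.2))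

theorem IsNear.comp [IsFiniteMeasure P] {P' : Measure Ω'} {j : Ω' → Ω} (hj : MeasurePreserving j P' P)
    (H : IsNear P a b g h ε) : IsNear P' (a ∘ j) (b ∘ j) g h ε := by
  obtain ⟨E, hE, H⟩ := H
  refine ⟨j ⁻¹' E, le_trans ?_ hE, fun ω hω ω' hω' => H _ hω _ hω'⟩
  refine ENNReal.toReal_mono (measure_ne_top _ _) ?_
  rw [← preimage_compl]
  exact (Measure.le_map_apply hj.measurable.aemeasurable _).trans (by rw [hj.map_eq])

theorem isNear_self (hε : 0 ≤ ε) : IsNear P a a g g ε :=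
  ⟨univ, by simpa using hε, by simp [hε]⟩

/-- The exceptional set can be taken to be determined by a closed set of the product. -/
theorem IsNear.exists_isClosed [IsFiniteMeasure P] (hg : Continuous g) (hh : Continuous h)
    (H : IsNear P a b g h ε) : ∃ S : Set (X × Y), IsClosed S ∧
      P.real ((fun ω => (a ω, b ω)) ⁻¹' S)ᶜ ≤ ε ∧ ∀ p ∈ S, ∀ q ∈ S,
        |dist (g p.1) q.1 - dist (h p.2) q.2| ≤ ε := by
  obtain ⟨E, hE, H⟩ := H
  refine ⟨closure ((fun ω => (a ω, b ω)) '' E), isClosed_closure, le_trans ?_ hE, ?_⟩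
  · refine measureReal_mono (compl_subset_compl.2 fun ω hω => subset_closure ⟨ω, hω, rfl⟩)
  · have key : closure ((fun ω => (a ω, b ω)) '' E) ×ˢ closure ((fun ω => (a ω, b ω)) '' E) ⊆
        {r : (X × Y) × (X × Y) | |dist (g r.1.1) r.2.1 - dist (h r.1.2) r.2.2| ≤ ε} := by
      rw [← closure_prod_eq]
      refine closure_minimal ?_ (isClosed_le (by fun_prop) continuous_const)
      rintro ⟨-, -⟩ ⟨⟨ω, hω, rfl⟩, ⟨ω', hω', rfl⟩⟩
      exact H ω hω ω' hω'
    exact fun p hp q hq => key (mk_mem_prod hp hq)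

end IsNear

/-! ### Couplings and their gluing -/

namespace MMSpace

variable {X Y Z : MMSpace.{u}}

instance : SecondCountableTopology X := UniformSpace.secondCountable_of_separable X

instance : Nonempty X := X.μ.nonempty_of_neZero

theorem Couplings.isProbabilityMeasure {π : Measure (X × Y)} (hπ : π ∈ Couplings X Y) :
    IsProbabilityMeasure π := by
  have h : IsProbabilityMeasure (π.map Prod.fst) := by rw [hπ.1]; infer_instance
  exact Measure.isProbabilityMeasure_of_map Prod.fst

/-- With `dπ_map_le`, this trades the infimum over closed subsets of the support for `IsNear`, where
neither condition appears. -/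
theorem isNear_of_dπ_lt {π : Measure (X × Y)} [IsProbabilityMeasure π] {g : X → X} {h : Y → Y}
    {ε : ℝ} (H : dπ π g h < ENNReal.ofReal ε) : IsNear π Prod.fst Prod.snd g h ε := by
  have hε : 0 ≤ ε := by
    by_contra hε
    simp [ENNReal.ofReal_of_nonpos (not_le.1 hε).le] at H
  simp only [dπ, iInf_lt_iff, max_lt_iff] at H
  obtain ⟨S, hS, -, h1, h2⟩ := H
  refine ⟨S, ?_, fun p hp q hq => ?_⟩
  · rw [← prob_compl_eq_one_sub hS.measurableSet] at h1
    exact ENNReal.toReal_le_of_le_ofReal hε h1.le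
  · have := (le_iSup₂_of_le (f := fun p (_ : p ∈ S) => ⨆ q ∈ S,
      ENNReal.ofReal |dist (g p.1) q.1 - dist (h p.2) q.2|) p hp
      (le_iSup₂_of_le q hq le_rfl)).trans h2.le
    exact (ENNReal.ofReal_le_ofReal_iff hε).1 this

theorem dπ_map_le {Ω : Type*} [MeasurableSpace Ω] {P : Measure Ω} [IsProbabilityMeasure P]
    {a : Ω → X} {b : Ω → Y} (ha : Measurable a) (hb : Measurable b) {g : X → X} {h : Y → Y}
    (hg : Continuous g) (hh : Continuous h) {ε : ℝ} (H : IsNear P a b g h ε) :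
    dπ (P.map fun ω => (a ω, b ω)) g h ≤ ENNReal.ofReal ε := by
  have hε := H.nonneg
  obtain ⟨S, hS, h1, h2⟩ := H.exists_isClosed hg hh
  have hab : Measurable fun ω => (a ω, b ω) := ha.prodMk hb
  set π := P.map fun ω => (a ω, b ω)
  have : IsProbabilityMeasure π := Measure.isProbabilityMeasure_map hab.aemeasurable
  -- The support is closed and conull, so intersecting with it costs no measure.
  refine iInf_le_of_le (S ∩ π.support) (iInf_le_of_le (hS.inter Measure.isClosed_support)
    (iInf_le_of_le inter_subset_right (max_le ?_ ?_)))
  · rw [measure_inter_conull Measure.measure_compl_support,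
      ← prob_compl_eq_one_sub hS.measurableSet, Measure.map_apply hab hS.measurableSet.compl]
    exact (ENNReal.le_ofReal_iff_toReal_le (measure_ne_top _ _) hε).2 h1
  · exact iSup₂_le fun p hp => iSup₂_le fun q hq => ENNReal.ofReal_le_ofReal (h2 p hp.1 q hq.1)

/-- Two couplings with a common marginal can be glued. -/
theorem exists_glue {π : Measure (X × Y)} (hπ : π ∈ Couplings X Y) {σ : Measure (Y × Z)}
    (hσ : σ ∈ Couplings Y Z) : ∃ P : Measure ((X × Y) × Z), IsProbabilityMeasure P ∧
      MeasurePreserving (fun p => p.1) P π ∧ MeasurePreserving (fun p => (p.1.2, p.2)) P σ := by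
  have := Couplings.isProbabilityMeasure hπ
  have := Couplings.isProbabilityMeasure hσ
  refine ⟨π.compProd (σ.condKernel.comap Prod.snd measurable_snd), inferInstance,
    ⟨measurable_fst, ?_⟩, ⟨by fun_prop, ?_⟩⟩
  · exact Measure.fst_compProd _ _
  · rw [Measure.map_compProd_comap, hπ.2, ← hσ.1]
    exact σ.disintegrate σ.condKernel

end MMSpace

/-! ### Pseudometric axioms for the box distance -/

namespace EqMMSpace

variable {Ω Ω' : Type*} [MeasurableSpace Ω] [MeasurableSpace Ω'] {A B C : EqMMSpace.{u}}
  {P : Measure Ω} {a : Ω → A.X} {b : Ω → B.X} {c : Ω → C.X} {ε ε' : ℝ}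

/-- The groups of `A` and `B` are at Hausdorff distance at most `ε` along the maps `a` and `b`. -/
def HausNear (A B : EqMMSpace.{u}) (P : Measure Ω) (a : Ω → A.X) (b : Ω → B.X) (ε : ℝ) : Prop :=
  (∀ g : A.G, ∃ h : B.G, IsNear P a b g.1.1 h.1.1 ε) ∧
    ∀ h : B.G, ∃ g : A.G, IsNear P a b g.1.1 h.1.1 ε

theorem HausNear.symm (H : HausNear A B P a b ε) : HausNear B A P b a ε :=
  ⟨fun h => (H.2 h).imp fun _ => IsNear.symm, fun g => (H.1 g).imp fun _ => IsNear.symm⟩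

theorem HausNear.nonneg (H : HausNear A B P a b ε) : 0 ≤ ε :=
  (H.1 1).choose_spec.nonneg

theorem HausNear.mono (H : HausNear A B P a b ε) (h : ε ≤ ε') : HausNear A B P a b ε' :=
  ⟨fun g => (H.1 g).imp fun _ H => H.mono h, fun g => (H.2 g).imp fun _ H => H.mono h⟩

theorem HausNear.trans [IsFiniteMeasure P] (H : HausNear A B P a b ε)
    (H' : HausNear B C P b c ε') : HausNear A C P a c (ε + ε') := by
  constructor
  · intro g
    obtain ⟨h, hh⟩ := H.1 g
    obtain ⟨k, hk⟩ := H'.1 h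
    exact ⟨k, hh.trans hk⟩
  · intro k
    obtain ⟨h, hh⟩ := H'.2 k
    obtain ⟨g, hg⟩ := H.2 h
    exact ⟨g, hg.trans hh⟩

theorem HausNear.comp [IsFiniteMeasure P] {P' : Measure Ω'} {j : Ω' → Ω}
    (hj : MeasurePreserving j P' P) (H : HausNear A B P a b ε) :
    HausNear A B P' (a ∘ j) (b ∘ j) ε :=
  ⟨fun g => (H.1 g).imp fun _ H => H.comp hj, fun g => (H.2 g).imp fun _ H => H.comp hj⟩

theorem exists_hausNear_of_box_lt (H : box A B < ENNReal.ofReal ε) :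
    ∃ π ∈ MMSpace.Couplings A.X B.X, HausNear A B π Prod.fst Prod.snd ε := by
  simp only [box, iInf_lt_iff] at H
  obtain ⟨π, hπ, H⟩ := H
  have := MMSpace.Couplings.isProbabilityMeasure hπ
  obtain ⟨H1, H2⟩ := max_lt_iff.1 H
  refine ⟨π, hπ, fun g => ?_, fun h => ?_⟩
  · obtain ⟨h, hh⟩ := iInf_lt_iff.1 ((le_iSup _ g).trans_lt H1)
    exact ⟨h, MMSpace.isNear_of_dπ_lt hh⟩
  · obtain ⟨g, hg⟩ := iInf_lt_iff.1 ((le_iSup _ h).trans_lt H2)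
    exact ⟨g, MMSpace.isNear_of_dπ_lt hg⟩

theorem box_le_of_hausNear [IsProbabilityMeasure P] (ha : MeasurePreserving a P A.X.μ)
    (hb : MeasurePreserving b P B.X.μ) (H : HausNear A B P a b ε) :
    box A B ≤ ENNReal.ofReal ε := by
  have hc : P.map (fun ω => (a ω, b ω)) ∈ MMSpace.Couplings A.X B.X := by
    constructor
    · rw [Measure.map_map measurable_fst (ha.measurable.prodMk hb.measurable)]
      exact ha.map_eq
    · rw [Measure.map_map measurable_snd (ha.measurable.prodMk hb.measurable)]
      exact hb.map_eq
  refine (iInf₂_le _ hc).trans (max_le (iSup_le fun g => ?_) (iSup_le fun h => ?_))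
  · obtain ⟨h, hh⟩ := H.1 g
    exact iInf_le_of_le h (MMSpace.dπ_map_le ha.measurable hb.measurable g.1.1.continuous
      h.1.1.continuous hh)
  · obtain ⟨g, hg⟩ := H.2 h
    exact iInf_le_of_le g (MMSpace.dπ_map_le ha.measurable hb.measurable g.1.1.continuous
      h.1.1.continuous hg)

theorem box_self (A : EqMMSpace.{u}) : box A A = 0 := by
  have h : HausNear A A A.X.μ id id 0 :=
    ⟨fun g => ⟨g, isNear_self le_rfl⟩, fun g => ⟨g, isNear_self le_rfl⟩⟩
  simpa using box_le_of_hausNear (MeasurePreserving.id _) (MeasurePreserving.id _) h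

/-- The empty set is good enough at error `1`, along any coupling. This makes the distance finite.
-/
theorem box_le_one (A B : EqMMSpace.{u}) : box A B ≤ 1 := by
  have h : ∀ (g : A.G) (h : B.G),
      IsNear (A.X.μ.prod B.X.μ) Prod.fst Prod.snd g.1.1 h.1.1 1 :=
    fun g h => ⟨∅, by simp, by simp⟩
  simpa using box_le_of_hausNear measurePreserving_fst measurePreserving_snd
    (⟨fun g => ⟨1, h g 1⟩, fun k => ⟨1, h 1 k⟩⟩ : HausNear A B _ _ _ 1)

theorem box_le_of_forall_hausNear {r : ℝ≥0∞} (h : ∀ ε : ℝ, r < ENNReal.ofReal ε →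
    box A B ≤ ENNReal.ofReal ε) : box A B ≤ r := by
  refine le_of_forall_gt_imp_ge_of_dense fun s hs => ?_
  rcases eq_or_ne s ⊤ with rfl | hs'
  · exact le_top
  · rw [← ENNReal.ofReal_toReal hs'] at hs ⊢
    exact h _ hs

theorem measurePreserving_fst_of_mem {π : Measure (A.X × B.X)}
    (hπ : π ∈ MMSpace.Couplings A.X B.X) : MeasurePreserving Prod.fst π A.X.μ :=
  ⟨measurable_fst, hπ.1⟩

theorem measurePreserving_snd_of_mem {π : Measure (A.X × B.X)}
    (hπ : π ∈ MMSpace.Couplings A.X B.X) : MeasurePreserving Prod.snd π B.X.μ :=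
  ⟨measurable_snd, hπ.2⟩

theorem box_comm_le (A B : EqMMSpace.{u}) : box A B ≤ box B A := by
  refine box_le_of_forall_hausNear fun ε hε => ?_
  obtain ⟨π, hπ, H⟩ := exists_hausNear_of_box_lt hε
  have := MMSpace.Couplings.isProbabilityMeasure hπ
  exact box_le_of_hausNear (measurePreserving_snd_of_mem hπ) (measurePreserving_fst_of_mem hπ)
    H.symm

theorem box_comm (A B : EqMMSpace.{u}) : box A B = box B A :=
  le_antisymm (box_comm_le A B) (box_comm_le B A)

theorem box_triangle (A B C : EqMMSpace.{u}) : box A C ≤ box A B + box B C := by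
  refine ENNReal.le_of_forall_pos_le_add fun δ hδ _ => ?_
  have hne : ∀ A B : EqMMSpace.{u}, box A B ≠ ⊤ := fun A B =>
    ((box_le_one A B).trans_lt ENNReal.one_lt_top).ne
  have key : ∀ A B : EqMMSpace.{u}, box A B < ENNReal.ofReal ((box A B).toReal + δ / 2) := by
    intro A B
    rw [ENNReal.ofReal_add ENNReal.toReal_nonneg (by positivity), ENNReal.ofReal_toReal (hne A B)]
    exact ENNReal.lt_add_right (hne A B) (by simpa using hδ)
  obtain ⟨π, hπ, H⟩ := exists_hausNear_of_box_lt (key A B)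
  obtain ⟨σ, hσ, H'⟩ := exists_hausNear_of_box_lt (key B C)
  have := MMSpace.Couplings.isProbabilityMeasure hπ
  have := MMSpace.Couplings.isProbabilityMeasure hσ
  obtain ⟨P, _, h1, h2⟩ := MMSpace.exists_glue hπ hσ
  refine (box_le_of_hausNear ((measurePreserving_fst_of_mem hπ).comp h1)
    ((measurePreserving_snd_of_mem hσ).comp h2) ((H.comp h1).trans (H'.comp h2))).trans ?_
  rw [show (box A B).toReal + δ / 2 + ((box B C).toReal + δ / 2)
    = (box A B).toReal + (box B C).toReal + δ by ring, ENNReal.ofReal_add (by positivity)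
      (by positivity), ENNReal.ofReal_add (by positivity) (by positivity),
      ENNReal.ofReal_toReal (hne _ _), ENNReal.ofReal_toReal (hne _ _), ENNReal.ofReal_coe_nnreal]

end EqMMSpace

/-! ### Measures of balls, composition and inversion -/

/-- Complements and outer regularity give `ν ≤ μ.map φ`, and comparable probability measures are
equal. The hypothesis is an upper bound on closed sets, which can be obtained in the limit from
closed thickenings. -/
theorem measurePreserving_of_forall_isClosed {X Y : Type*} [MeasurableSpace X]
    [PseudoMetricSpace Y] [MeasurableSpace Y] [BorelSpace Y] {μ : Measure X} {ν : Measure Y}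
    [IsProbabilityMeasure μ] [IsProbabilityMeasure ν] {φ : X → Y} (hφ : Measurable φ)
    (h : ∀ K, IsClosed K → μ (φ ⁻¹' K) ≤ ν K) : MeasurePreserving φ μ ν := by
  have := Measure.isProbabilityMeasure_map (μ := μ) hφ.aemeasurable
  refine ⟨hφ, (Measure.eq_of_le_of_isProbabilityMeasure (Measure.le_iff'.2 fun A => ?_)).symm⟩
  rw [A.measure_eq_iInf_isOpen (μ.map φ)]
  refine le_iInf fun U => le_iInf fun hAU => le_iInf fun hU => (measure_mono hAU).trans ?_
  have h1 := h Uᶜ hU.isClosed_compl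
  rw [← Measure.map_apply hφ hU.measurableSet.compl, prob_compl_eq_one_sub hU.measurableSet,
    prob_compl_eq_one_sub hU.measurableSet] at h1
  exact (ENNReal.sub_le_sub_iff_left prob_le_one ENNReal.one_ne_top).1 h1

namespace MMSpace

variable {X Y : MMSpace.{u}}

theorem exists_isCompact_measureReal_compl_le (X : MMSpace.{u}) {ε : ℝ} (hε : 0 < ε) :
    ∃ K : Set X, IsCompact K ∧ X.μ.real Kᶜ ≤ ε := by
  obtain ⟨K, hK, h⟩ := isTightMeasureSet_iff_exists_isCompact_measure_compl_le.1
    (isTightMeasureSet_singleton (μ := X.μ)) (ENNReal.ofReal ε) (by simpa using hε)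
  exact ⟨K, hK, ENNReal.toReal_le_of_le_ofReal hε.le (h _ rfl)⟩

/-- Up to small measure, the measures of balls of a given radius are bounded from below. -/
theorem exists_measureReal_ball_le (X : MMSpace.{u}) {r η : ℝ} (hr : 0 < r) (hη : 0 < η) :
    ∃ t > 0, X.μ.real {x | X.μ.real (Metric.ball x r) ≤ t} ≤ η := by
  obtain ⟨K, hK, hKη⟩ := X.exists_isCompact_measureReal_compl_le hη
  have key : ∃ t > 0, ∀ x ∈ K, t < X.μ.real (Metric.ball x r) := by
    refine hK.induction_on (p := fun s => ∃ t > 0, ∀ x ∈ s, t < X.μ.real (Metric.ball x r))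
      ⟨1, one_pos, by simp⟩ ?_ ?_ ?_
    · rintro s s' hs ⟨t, ht, h⟩
      exact ⟨t, ht, fun x hx => h x (hs hx)⟩
    · rintro s s' ⟨t, ht, h⟩ ⟨t', ht', h'⟩
      refine ⟨min t t', lt_min ht ht', fun x hx => ?_⟩
      rcases hx with hx | hx
      · exact (min_le_left _ _).trans_lt (h x hx)
      · exact (min_le_right _ _).trans_lt (h' x hx)
    · intro x _
      have hpos : 0 < X.μ.real (Metric.ball x (r / 2)) :=
        ENNReal.toReal_pos (Metric.measure_ball_pos _ _ (half_pos hr)).ne' (measure_ne_top _ _)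
      -- For `y` within `r / 2` of `x`, the ball of radius `r` at `y` contains that of radius `r /
      -- 2` at `x`.
      refine ⟨_, mem_nhdsWithin_of_mem_nhds (Metric.ball_mem_nhds x (half_pos hr)), _,
        half_pos hpos, fun y hy => (half_lt_self hpos).trans_le (measureReal_mono ?_)⟩
      refine Metric.ball_subset_ball' ?_
      rw [dist_comm]
      linarith [Metric.mem_ball.1 hy]
  obtain ⟨t, ht, h⟩ := key
  exact ⟨t, ht, (measureReal_mono fun x hx hxK => (h x hxK).not_ge hx).trans hKη⟩

theorem Aut.measureReal_ball (g : X.Aut) (x : X) (r : ℝ) :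
    X.μ.real (Metric.ball (g.1 x) r) = X.μ.real (Metric.ball x r) := by
  have hg : MeasurePreserving g.1 X.μ X.μ := g.2
  rw [← hg.measureReal_preimage Metric.isOpen_ball.measurableSet.nullMeasurableSet,
    g.1.isometry.preimage_ball]

/-- If the exceptional set of `E` is small, then `a` maps some point of `E` near `g (a ω)`, for all
points `ω` outside a set of small measure. -/
theorem exists_mem_dist_lt {Ω : Type*} [MeasurableSpace Ω] {P : Measure Ω} [IsProbabilityMeasure P]
    {a : Ω → X} (ha : MeasurePreserving a P X.μ) (g : X.Aut) {r t : ℝ} {E : Set Ω}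
    (hE : P.real Eᶜ ≤ t) {ω : Ω} (hω : t < X.μ.real (Metric.ball (a ω) r)) :
    ∃ ω' ∈ E, dist (a ω') (g.1 (a ω)) < r := by
  -- The ball at `g (a ω)` is as heavy as the one at `a ω`, so its preimage does not fit in the
  -- complement of `E`.
  rw [← Aut.measureReal_ball g,
    ← ha.measureReal_preimage Metric.isOpen_ball.measurableSet.nullMeasurableSet] at hω
  by_contra! H
  refine (hE.trans_lt hω).not_ge (measureReal_mono fun ω' hω' hE' => (H ω' hE').not_gt hω')

theorem IsClosedSubgroup.mem {G : Subgroup X.Aut} (hG : X.IsClosedSubgroup G) {h : X.Aut}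
    (H : ∀ ε > 0, ∃ g ∈ G, X.μ.real {x | ε ≤ dist (g.1 x) (h.1 x)} ≤ ε) : h ∈ G := by
  choose g hg hgε using fun n : ℕ => H (1 / ((n : ℝ) + 1)) Nat.one_div_pos_of_nat
  refine hG g h hg (tendstoInMeasure_iff_measureReal_dist.2 fun ε hε => ?_)
  refine squeeze_zero' (.of_forall fun _ => measureReal_nonneg) ?_
    tendsto_one_div_add_atTop_nhds_zero_nat
  filter_upwards [tendsto_one_div_add_atTop_nhds_zero_nat.eventually (gt_mem_nhds hε)] with n hn
  exact (measureReal_mono fun x hx => hn.le.trans hx).trans (hgε n)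

/-- Inversion transposes the kernel, so inverses cost nothing in closeness arguments. -/
theorem Aut.dist_inv_apply (g : X.Aut) (x y : X) :
    dist (g⁻¹.1 x) y = dist (g.1 y) x := by
  rw [← g.1.dist_eq, dist_comm]
  congr 1
  exact g.1.apply_symm_apply x

theorem isNear_inv {Ω : Type*} [MeasurableSpace Ω] {P : Measure Ω} {a : Ω → X} {b : Ω → Y}
    {g : X.Aut} {h : Y.Aut} {ε : ℝ} (H : IsNear P a b g.1 h.1 ε) :
    IsNear P a b g⁻¹.1 h⁻¹.1 ε := by
  obtain ⟨E, hE, H⟩ := H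
  exact ⟨E, hE, fun ω hω ω' hω' => by
    rw [Aut.dist_inv_apply, Aut.dist_inv_apply]; exact H ω' hω' ω hω⟩

/-- To apply closeness of `g` and `h` after `g'` and `h'`, replace `g' (a ω)` by a nearby `a ω₃`
with `ω₃` good; then `h' (b ω)` is near `b ω₃`. The bound `ε` depends only on `X` and `η`, so it
serves for a whole sequence of spaces `Y`. -/
theorem exists_forall_isNear_comp (X : MMSpace.{u}) {η : ℝ} (hη : 0 < η) : ∃ ε > 0,
    ∀ {Y : MMSpace.{u}} {Ω : Type u} [MeasurableSpace Ω] {P : Measure Ω} [IsProbabilityMeasure P]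
      {a : Ω → X} {b : Ω → Y} {g g' : X.Aut} {h h' : Y.Aut}, MeasurePreserving a P X.μ →
      IsNear P a b g.1 h.1 ε → IsNear P a b g'.1 h'.1 ε →
      IsNear P a b (g * g').1 (h * h').1 η := by
  obtain ⟨t, ht, hX⟩ := X.exists_measureReal_ball_le (r := η / 8) (η := η / 4) (by positivity)
    (by positivity)
  -- Two exceptional sets must stay below `t` together, hence `t / 2`.
  refine ⟨min (t / 2) (η / 8), by positivity, ?_⟩
  rintro Y Ω _ P _ a b g g' h h' ha ⟨E, hE, H⟩ ⟨E', hE', H'⟩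
  have hEE' : P.real (E ∩ E')ᶜ ≤ 2 * min (t / 2) (η / 8) := by
    rw [compl_inter]
    exact (measureReal_union_le _ _).trans (by linarith)
  have ht' := min_le_left (t / 2) (η / 8)
  have hη' := min_le_right (t / 2) (η / 8)
  refine ⟨(E ∩ E') ∩ {ω | t < X.μ.real (Metric.ball (a ω) (η / 8))}, ?_, ?_⟩
  · rw [compl_inter]
    refine (measureReal_union_le _ _).trans ?_
    have h1 : P.real {ω | t < X.μ.real (Metric.ball (a ω) (η / 8))}ᶜ ≤ η / 4 := by
      refine le_trans ?_ hX
      refine ENNReal.toReal_mono (measure_ne_top _ _) ?_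
      rw [← ha.map_eq]
      refine (measure_mono ?_).trans (Measure.le_map_apply ha.measurable.aemeasurable _)
      intro ω hω
      simpa [ha.map_eq] using hω
    linarith
  · rintro ω ⟨⟨hω, hω'⟩, hb⟩ ω' ⟨⟨hω1, -⟩, -⟩
    obtain ⟨ω₃, h3, hd⟩ := exists_mem_dist_lt ha g' (hEE'.trans (by linarith)) hb
    have e1 := H ω₃ h3.1 ω' hω1
    have e2 := H' ω hω' ω₃ h3.2
    have e3 : dist (h'.1 (b ω)) (b ω₃) ≤ 2 * (η / 8) := by
      rw [dist_comm] at hd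
      linarith [(abs_le.1 e2).1]
    have e4 : |dist (g.1 (g'.1 (a ω))) (a ω') - dist (g.1 (a ω₃)) (a ω')| ≤ η / 8 := by
      refine (abs_dist_sub_le _ _ _).trans ?_
      rw [g.1.dist_eq, dist_comm]
      exact hd.le
    have e5 : |dist (h.1 (h'.1 (b ω))) (b ω') - dist (h.1 (b ω₃)) (b ω')| ≤ 2 * (η / 8) := by
      refine (abs_dist_sub_le _ _ _).trans ?_
      rwa [h.1.dist_eq]
    change |dist (g.1 (g'.1 (a ω))) (a ω') - dist (h.1 (h'.1 (b ω))) (b ω')| ≤ η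
    rw [abs_le] at e1 e4 e5 ⊢
    constructor <;> linarith [e1.1, e1.2, e4.1, e4.2, e5.1, e5.2]

end MMSpace

/-- The partner `h` of the identity need not be the identity, but the diagonal of the kernel shows
that it moves good points by at most `ε`; replacing it costs a second `ε`. -/
theorem EqMMSpace.HausNear.isNear_id {Ω : Type*} [MeasurableSpace Ω] {A B : EqMMSpace.{u}}
    {P : Measure Ω} {a : Ω → A.X} {b : Ω → B.X} {ε : ℝ} (H : HausNear A B P a b ε) :
    IsNear P a b id id (2 * ε) := by
  have hε := H.nonneg
  obtain ⟨h, E, hE, H⟩ := H.1 1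
  refine ⟨E, by linarith, fun ω hω ω' hω' => ?_⟩
  have e1 : |dist (a ω) (a ω) - dist (h.1.1 (b ω)) (b ω)| ≤ ε := H ω hω ω hω
  have e2 : |dist (a ω) (a ω') - dist (h.1.1 (b ω)) (b ω')| ≤ ε := H ω hω ω' hω'
  have e3 := abs_dist_sub_le (h.1.1 (b ω)) (b ω) (b ω')
  rw [dist_self] at e1
  simp only [id]
  rw [abs_le] at e1 e2 e3 ⊢
  constructor <;> linarith [e1.1, e1.2, e2.1, e2.2, e3.1, e3.2]

/-! ### Isometric relations and vanishing distance -/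

section Relation

variable {X Y : Type*} [MetricSpace X] [MetricSpace Y] [CompleteSpace Y]
  {R : Set (X × Y)}

theorem exists_mem_of_isometric_relation (hR : IsClosed R)
    (hd : ∀ p ∈ R, ∀ q ∈ R, dist p.1 q.1 = dist p.2 q.2)
    (hX : ∀ x : X, ∀ δ > 0, ∃ p ∈ R, dist p.1 x ≤ δ) (x : X) : ∃ y, (x, y) ∈ R := by
  choose p hp hpx using fun n : ℕ => hX x (1 / ((n : ℝ) + 1)) Nat.one_div_pos_of_nat
  have h1 : Tendsto (fun n => (p n).1) atTop (𝓝 x) :=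
    tendsto_iff_dist_tendsto_zero.2 (squeeze_zero (fun _ => dist_nonneg) hpx
      tendsto_one_div_add_atTop_nhds_zero_nat)
  have h2 : CauchySeq fun n => (p n).2 := by
    have := h1.cauchySeq
    rw [Metric.cauchySeq_iff] at this ⊢
    simpa only [hd _ (hp _) _ (hp _)] using this
  obtain ⟨y, hy⟩ := cauchySeq_tendsto_of_complete h2
  exact ⟨y, hR.mem_of_tendsto (h1.prodMk_nhds hy) (.of_forall hp)⟩

/-- A closed isometric relation with dense projections is the graph of an isometry. -/
theorem exists_isometryEquiv_of_relation [CompleteSpace X] (hR : IsClosed R)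
    (hd : ∀ p ∈ R, ∀ q ∈ R, dist p.1 q.1 = dist p.2 q.2)
    (hX : ∀ x : X, ∀ δ > 0, ∃ p ∈ R, dist p.1 x ≤ δ)
    (hY : ∀ y : Y, ∀ δ > 0, ∃ p ∈ R, dist p.2 y ≤ δ) :
    ∃ φ : X ≃ᵢ Y, ∀ p ∈ R, φ p.1 = p.2 := by
  choose f hf using exists_mem_of_isometric_relation hR hd hX
  choose k hk using exists_mem_of_isometric_relation (R := Prod.swap ⁻¹' R)
    (hR.preimage continuous_swap) (fun p hp q hq => (hd _ hp _ hq).symm)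
    fun y δ hδ => by
      obtain ⟨p, hp, h⟩ := hY y δ hδ
      exact ⟨p.swap, by simpa using hp, h⟩
  refine ⟨IsometryEquiv.mk' f k (fun y => ?_) (Isometry.of_dist_eq fun x x' => ?_), fun p hp => ?_⟩
  · rw [← dist_eq_zero]
    exact (hd _ (hf (k y)) _ (hk y)).symm.trans (dist_self _)
  · exact (hd _ (hf x) _ (hf x')).symm
  · change f p.1 = p.2
    rw [← dist_eq_zero]
    exact (hd _ (hf p.1) _ hp).symm.trans (dist_self _)

end Relation

namespace EqMMSpace

variable {A B : EqMMSpace.{u}}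

/-- If `b` is asymptotically the composition of `a` with an isometry `φ`, and the groups are
asymptotically close along `a` and `b`, then `φ` conjugates the first group into the second. -/
theorem exists_conj_mem {Ω ι : Type*} [MeasurableSpace Ω] {l : Filter ι} [l.NeBot]
    {P : ι → Measure Ω} [∀ i, IsProbabilityMeasure (P i)] {a : Ω → A.X} {b : Ω → B.X}
    (ha : ∀ i, MeasurePreserving a (P i) A.X.μ) (hb : ∀ i, MeasurePreserving b (P i) B.X.μ)
    {ε : ι → ℝ} (hε : Tendsto ε l (𝓝 0)) (φ : A.X ≃ᵢ B.X)
    (hφ : MeasurePreserving φ A.X.μ B.X.μ)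
    (hab : ∀ δ > 0, Tendsto (fun i => (P i).real {ω | δ ≤ dist (φ (a ω)) (b ω)}) l (𝓝 0))
    {g : A.X.Aut} (hg : ∀ i, ∃ h : B.G, IsNear (P i) a b g.1 h.1.1 (ε i)) :
    ∃ h : B.G, ∀ x, φ (g.1 x) = h.1.1 (φ x) := by
  have hφ' : MeasurePreserving φ.symm B.X.μ A.X.μ :=
    MeasurePreserving.symm φ.toHomeomorph.toMeasurableEquiv hφ
  have hg2 : MeasurePreserving g.1 A.X.μ A.X.μ := g.2
  let h₀ : B.X.Aut := ⟨φ.symm.trans (g.1.trans φ), hφ.comp (hg2.comp hφ')⟩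
  have hh₀ : ∀ y, h₀.1 y = φ (g.1 (φ.symm y)) := fun _ => rfl
  -- By closedness it suffices to approximate the conjugate `h₀` in measure by partners of `g` at
  -- suitable indices.
  refine ⟨⟨h₀, B.closed.mem fun η hη => ?_⟩, fun x => by simp [hh₀]⟩
  obtain ⟨t, ht, hX⟩ := A.X.exists_measureReal_ball_le (r := η / 8) (η := η / 2) (by positivity)
    (by positivity)
  have hs : 0 < min (η / 4) (t / 2) := by positivity
  have e1 : ∀ᶠ i in l, ε i < min (η / 4) (t / 2) := hε.eventually (gt_mem_nhds hs)
  have e2 : ∀ᶠ i in l, (P i).real {ω | η / 8 ≤ dist (φ (a ω)) (b ω)} < min (η / 4) (t / 2) :=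
    (hab (η / 8) (by positivity)).eventually (gt_mem_nhds hs)
  obtain ⟨i, hi1, hi2⟩ := (e1.and e2).exists
  obtain ⟨h, E, hE, H⟩ := hg i
  have m1 := min_le_left (η / 4) (t / 2)
  have m2 := min_le_right (η / 4) (t / 2)
  set F := E ∩ {ω | dist (φ (a ω)) (b ω) < η / 8}
  have hF : (P i).real Fᶜ ≤ 2 * min (η / 4) (t / 2) := by
    have : {ω | dist (φ (a ω)) (b ω) < η / 8}ᶜ = {ω | η / 8 ≤ dist (φ (a ω)) (b ω)} := by
      ext; simp
    rw [compl_inter, this]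
    exact (measureReal_union_le _ _).trans (by linarith)
  refine ⟨h.1, h.2, ?_⟩
  have hm : MeasurableSet {y | η ≤ dist (h.1.1 y) (h₀.1 y)} :=
    (isClosed_le continuous_const (h.1.1.continuous.dist h₀.1.continuous)).measurableSet
  rw [← (hb i).measureReal_preimage hm.nullMeasurableSet]
  -- Otherwise some good `ω'` has `a ω'` near `g (a ω)`, and then `b ω'` is near both `h (b ω)` and
  -- `h₀ (b ω)`.
  have hsub : b ⁻¹' {y | η ≤ dist (h.1.1 y) (h₀.1 y)} ⊆
      Fᶜ ∪ a ⁻¹' {x | A.X.μ.real (Metric.ball x (η / 8)) ≤ t} := by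
    intro ω hω
    by_contra hcon
    simp only [mem_union, not_or, notMem_compl_iff, mem_preimage, mem_ofPred_eq, not_le] at hcon
    obtain ⟨hωF, hball⟩ := hcon
    obtain ⟨ω', hω', hd⟩ := MMSpace.exists_mem_dist_lt (ha i) g (hF.trans (by linarith)) hball
    have d1 : dist (h.1.1 (b ω)) (b ω') ≤ dist (g.1 (a ω)) (a ω') + ε i := by
      linarith [(abs_le.1 (H ω hωF.1 ω' hω'.1)).1]
    have d2 : dist (h₀.1 (b ω)) (φ (g.1 (a ω))) < η / 8 := by
      rw [hh₀, φ.dist_eq, g.1.dist_eq, ← φ.dist_eq, φ.apply_symm_apply, dist_comm]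
      exact hωF.2
    have d3 : dist (φ (g.1 (a ω))) (φ (a ω')) < η / 8 := by
      rw [φ.dist_eq, dist_comm]
      exact hd
    have d4 : dist (φ (a ω')) (b ω') < η / 8 := hω'.2
    rw [dist_comm] at hd
    have hω2 : η ≤ dist (h.1.1 (b ω)) (h₀.1 (b ω)) := hω
    have t1 := dist_triangle_right (h.1.1 (b ω)) (h₀.1 (b ω)) (b ω')
    have t2 := dist_triangle4 (h₀.1 (b ω)) (φ (g.1 (a ω))) (φ (a ω')) (b ω')
    linarith
  have hlast : (P i).real (a ⁻¹' {x | A.X.μ.real (Metric.ball x (η / 8)) ≤ t}) ≤ η / 2 := by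
    refine le_trans ?_ hX
    refine ENNReal.toReal_mono (measure_ne_top _ _) ?_
    exact (Measure.le_map_apply (ha i).measurable.aemeasurable _).trans (by rw [(ha i).map_eq])
  have := (measureReal_mono (μ := P i) hsub).trans (measureReal_union_le _ _)
  linarith

/-- Couplings which are asymptotically isometric concentrate, along an ultrafilter, near the graph
of a measure preserving isometry. -/
theorem exists_isometryEquiv_of_isNear_id {X Y : MMSpace.{u}} {π : ℕ → Measure (X × Y)}
    (hπ : ∀ n, π n ∈ MMSpace.Couplings X Y) {ε : ℕ → ℝ} {l : Ultrafilter ℕ}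
    (hε : Tendsto ε l (𝓝 0)) (H : ∀ n, IsNear (π n) Prod.fst Prod.snd id id (ε n)) :
    ∃ φ : X ≃ᵢ Y, MeasurePreserving φ X.μ Y.μ ∧ ∀ δ > 0,
      Tendsto (fun n => (π n).real {p | δ ≤ dist (φ p.1) p.2}) l (𝓝 0) := by
  have hprob := fun n => MMSpace.Couplings.isProbabilityMeasure (hπ n)
  let small : Set (X × Y) → Prop := fun C => Tendsto (fun n => (π n).real C) l (𝓝 0)
  have small_mono : ∀ {C D : Set (X × Y)}, C ⊆ D → small D → small C := fun hCD hD =>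
    squeeze_zero (fun _ => measureReal_nonneg) (fun n => measureReal_mono hCD) hD
  -- Here the ultrafilter matters: two sets that are not small are both heavy at a common index.
  have not_small : ∀ {C : Set (X × Y)}, ¬ small C → ∃ c > 0, ∀ᶠ n in (l : Filter ℕ),
      c ≤ (π n).real C := by
    intro C hC
    by_contra! hcon
    refine hC (tendsto_order.2 ⟨fun c hc => .of_forall fun n => hc.trans_le measureReal_nonneg,
      fun c hc => ?_⟩)
    exact hcon c hc
  -- The points near which mass persists; this will be the graph of `φ`.
  let R : Set (X × Y) := {p | ∀ V ∈ 𝓝 p, ¬ small V}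
  have hRc : IsClosed R := by
    refine isClosed_of_closure_subset fun p hp V hV hs => ?_
    obtain ⟨q, hq1, hq2⟩ := mem_closure_iff.1 hp _ isOpen_interior (mem_interior_iff_mem_nhds.2 hV)
    exact hq2 V (mem_interior_iff_mem_nhds.1 hq1) hs
  have small_of_isCompact : ∀ K : Set (X × Y), IsCompact K → (∀ p ∈ K, p ∉ R) → small K := by
    intro K hK hKR
    refine hK.induction_on (p := small) (by simp [small]) (fun s t => small_mono)
      (fun s t hs ht => ?_) fun p hp => ?_
    · refine squeeze_zero (fun _ => measureReal_nonneg) (fun n => measureReal_union_le _ _) ?_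
      simpa using hs.add ht
    · have := hKR p hp
      simp only [R, mem_ofPred_eq, not_forall, not_not] at this
      obtain ⟨V, hV, hs⟩ := this
      exact ⟨V, mem_nhdsWithin_of_mem_nhds hV, hs⟩
  have real_fst : ∀ n {s : Set X}, MeasurableSet s → (π n).real (Prod.fst ⁻¹' s) = X.μ.real s :=
    fun n s hs => MeasurePreserving.measureReal_preimage ⟨measurable_fst, (hπ n).1⟩
      hs.nullMeasurableSet
  have real_snd : ∀ n {s : Set Y}, MeasurableSet s → (π n).real (Prod.snd ⁻¹' s) = Y.μ.real s :=
    fun n s hs => MeasurePreserving.measureReal_preimage ⟨measurable_snd, (hπ n).2⟩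
      hs.nullMeasurableSet
  have small_of_isClosed : ∀ C : Set (X × Y), IsClosed C → (∀ p ∈ C, p ∉ R) → small C := by
    intro C hC hCR
    refine tendsto_order.2 ⟨fun c hc => .of_forall fun n => hc.trans_le measureReal_nonneg,
      fun c hc => ?_⟩
    -- The marginals do not depend on `n`, so one compact rectangle carries all but `2c / 3` of
    -- every `π n`.
    obtain ⟨K, hK, hKc⟩ := X.exists_isCompact_measureReal_compl_le (ε := c / 3) (by positivity)
    obtain ⟨L, hL, hLc⟩ := Y.exists_isCompact_measureReal_compl_le (ε := c / 3) (by positivity)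
    have hs := small_of_isCompact _ ((hK.prod hL).inter_right hC) fun p hp => hCR p hp.2
    filter_upwards [hs.eventually (gt_mem_nhds (show 0 < c / 3 by positivity))] with n hn
    have hsub : C ⊆ (K ×ˢ L ∩ C) ∪ (Prod.fst ⁻¹' Kᶜ ∪ Prod.snd ⁻¹' Lᶜ) := by
      intro p hp
      by_cases h1 : p.1 ∈ K
      · by_cases h2 : p.2 ∈ L
        · exact Or.inl ⟨⟨h1, h2⟩, hp⟩
        · exact Or.inr (Or.inr h2)
      · exact Or.inr (Or.inl h1)
    have i1 := measureReal_mono (μ := π n) hsub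
    have i2 := measureReal_union_le (μ := π n) (K ×ˢ L ∩ C) (Prod.fst ⁻¹' Kᶜ ∪ Prod.snd ⁻¹' Lᶜ)
    have i3 := measureReal_union_le (μ := π n) (Prod.fst ⁻¹' Kᶜ) (Prod.snd ⁻¹' Lᶜ)
    rw [real_fst n hK.isClosed.measurableSet.compl, real_snd n hL.isClosed.measurableSet.compl]
      at i3
    linarith
  have hRd : ∀ p ∈ R, ∀ q ∈ R, dist p.1 q.1 = dist p.2 q.2 := by
    intro p hp q hq
    rw [← sub_eq_zero, ← abs_eq_zero]
    refine le_antisymm (le_of_forall_pos_le_add fun δ hδ => ?_) (abs_nonneg _)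
    -- Moving four coordinates by `δ / 8` and the error `δ / 2` of the kernels add up to `δ`.
    obtain ⟨c, hc, hpc⟩ := not_small (hp _ (Metric.ball_mem_nhds p (show 0 < δ / 8 by positivity)))
    obtain ⟨c', hc', hqc⟩ := not_small (hq _ (Metric.ball_mem_nhds q (show 0 < δ / 8 by positivity)))
    have e := hε.eventually (gt_mem_nhds (show 0 < min (δ / 2) (min c c') by positivity))
    obtain ⟨n, ⟨h1, h2⟩, h3⟩ := ((hpc.and hqc).and e).exists
    obtain ⟨E, hE, HE⟩ := H n
    have meet : ∀ {V : Set (X × Y)}, ε n < (π n).real V → ∃ r ∈ V, r ∈ E := by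
      intro V hV
      by_contra! hcon
      exact (hE.trans_lt hV).not_ge (measureReal_mono fun r hr => hcon r hr)
    obtain ⟨p', hp', hpE⟩ := meet
      ((h3.trans_le ((min_le_right _ _).trans (min_le_left _ _))).trans_le h1)
    obtain ⟨q', hq', hqE⟩ := meet
      ((h3.trans_le ((min_le_right _ _).trans (min_le_right _ _))).trans_le h2)
    have h4 := HE p' hpE q' hqE
    have h5 := h3.trans_le (min_le_left _ _)
    rw [Metric.mem_ball, Prod.dist_eq, max_lt_iff] at hp' hq'
    have a1 := dist_dist_dist_le p.1 q.1 p'.1 q'.1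
    have a2 := dist_dist_dist_le p.2 q.2 p'.2 q'.2
    rw [Real.dist_eq, dist_comm p.1 p'.1, dist_comm q.1 q'.1] at a1
    rw [Real.dist_eq, dist_comm p.2 p'.2, dist_comm q.2 q'.2] at a2
    simp only [id] at h4
    rw [abs_le] at a1 a2 h4 ⊢
    constructor <;> linarith [a1.1, a1.2, a2.1, a2.2, h4.1, h4.2, hp'.1, hp'.2, hq'.1, hq'.2]
  have hRX : ∀ x : X, ∀ δ > 0, ∃ p ∈ R, dist p.1 x ≤ δ := by
    intro x δ hδ
    -- If `R` misses the cylinder over a ball, the cylinder is small, yet its mass is a positive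
    -- constant by full support.
    by_contra! hcon
    have hs := small_of_isClosed (Prod.fst ⁻¹' Metric.closedBall x δ)
      (Metric.isClosed_closedBall.preimage continuous_fst) fun p hp hpR => (hcon p hpR).not_ge hp
    have hpos : 0 < X.μ.real (Metric.closedBall x δ) :=
      ENNReal.toReal_pos (Metric.measure_closedBall_pos _ _ hδ).ne' (measure_ne_top _ _)
    simp only [small, real_fst _ Metric.isClosed_closedBall.measurableSet] at hs
    exact hpos.ne (tendsto_nhds_unique hs tendsto_const_nhds)
  have hRY : ∀ y : Y, ∀ δ > 0, ∃ p ∈ R, dist p.2 y ≤ δ := by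
    intro y δ hδ
    by_contra! hcon
    have hs := small_of_isClosed (Prod.snd ⁻¹' Metric.closedBall y δ)
      (Metric.isClosed_closedBall.preimage continuous_snd) fun p hp hpR => (hcon p hpR).not_ge hp
    have hpos : 0 < Y.μ.real (Metric.closedBall y δ) :=
      ENNReal.toReal_pos (Metric.measure_closedBall_pos _ _ hδ).ne' (measure_ne_top _ _)
    simp only [small, real_snd _ Metric.isClosed_closedBall.measurableSet] at hs
    exact hpos.ne (tendsto_nhds_unique hs tendsto_const_nhds)
  obtain ⟨φ, hφ⟩ := exists_isometryEquiv_of_relation hRc hRd hRX hRY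
  have hsmall : ∀ δ > 0, small {p | δ ≤ dist (φ p.1) p.2} := by
    intro δ hδ
    refine small_of_isClosed _ (isClosed_le continuous_const
      ((φ.continuous.comp continuous_fst).dist continuous_snd)) fun p hp hpR => ?_
    rw [mem_ofPred_eq, hφ p hpR, dist_self] at hp
    exact hp.not_gt hδ
  refine ⟨φ, measurePreserving_of_forall_isClosed φ.continuous.measurable fun K hK => ?_, hsmall⟩
  -- The couplings bound the measure of `φ ⁻¹' K` by that of a thickening of `K` plus a vanishing
  -- term; then the thickening shrinks.
  refine ge_of_tendsto ((tendsto_measure_cthickening_of_isClosed ⟨1, one_pos, measure_ne_top _ _⟩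
    hK).mono_left (nhdsWithin_le_nhds (s := Ioi 0))) ?_
  filter_upwards [self_mem_nhdsWithin] with δ (hδ : 0 < δ)
  rw [← ENNReal.toReal_le_toReal (measure_ne_top _ _) (measure_ne_top _ _)]
  change X.μ.real _ ≤ Y.μ.real _
  have hlim : Tendsto (fun n => Y.μ.real (Metric.cthickening δ K) +
      (π n).real {p | δ ≤ dist (φ p.1) p.2}) l (𝓝 (Y.μ.real (Metric.cthickening δ K) + 0)) :=
    tendsto_const_nhds.add (hsmall δ hδ)
  rw [add_zero] at hlim
  refine ge_of_tendsto' hlim fun n => ?_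
  rw [← real_fst n (φ.continuous.measurable hK.measurableSet),
    ← real_snd n Metric.isClosed_cthickening.measurableSet]
  refine (measureReal_mono fun p hp => ?_).trans (measureReal_union_le _ _)
  by_cases hpd : δ ≤ dist (φ p.1) p.2
  · exact Or.inr hpd
  · refine Or.inl (Metric.mem_cthickening_of_dist_le p.2 (φ p.1) δ K hp ?_)
    rw [dist_comm]
    exact (not_le.1 hpd).le

theorem iso_of_box_eq_zero (h : box A B = 0) : Iso A B := by
  have hpos : ∀ n : ℕ, box A B < ENNReal.ofReal (1 / ((n : ℝ) + 1)) := fun n => by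
    rw [h, ENNReal.ofReal_pos]
    exact Nat.one_div_pos_of_nat
  choose π hπ H using fun n => exists_hausNear_of_box_lt (hpos n)
  have hprob := fun n => MMSpace.Couplings.isProbabilityMeasure (hπ n)
  have hl : ((hyperfilter ℕ : Ultrafilter ℕ) : Filter ℕ) ≤ atTop := Nat.hyperfilter_le_atTop
  have hε : Tendsto (fun n : ℕ => 1 / ((n : ℝ) + 1)) (hyperfilter ℕ) (𝓝 0) :=
    tendsto_one_div_add_atTop_nhds_zero_nat.mono_left hl
  obtain ⟨φ, hφ, hδ⟩ := exists_isometryEquiv_of_isNear_id hπ (l := hyperfilter ℕ)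
    (ε := fun n => 2 * (1 / ((n : ℝ) + 1))) (by simpa using hε.const_mul 2)
    fun n => (H n).isNear_id
  have hA := fun n => measurePreserving_fst_of_mem (hπ n)
  have hB := fun n => measurePreserving_snd_of_mem (hπ n)
  have hφ' : MeasurePreserving φ.symm B.X.μ A.X.μ :=
    MeasurePreserving.symm φ.toHomeomorph.toMeasurableEquiv hφ
  have c1 := fun g : A.G => exists_conj_mem hA hB hε φ hφ hδ fun n => (H n).1 g
  -- Conjugation by `φ.symm` supplies the surjectivity of `ρ`.
  have c2 := fun k : B.G => exists_conj_mem hB hA hε φ.symm hφ'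
    (by
      intro δ h0
      convert! hδ δ h0 using 6 with n p
      rw [← φ.dist_eq, φ.apply_symm_apply, dist_comm])
    fun n => (H n).symm.1 k
  choose ρ hρ using c1
  have hbij : Function.Bijective ρ := by
    constructor
    · intro g g' hgg
      refine Subtype.ext (Subtype.ext (IsometryEquiv.ext fun x => φ.injective ?_))
      rw [hρ, hρ, hgg]
    · intro k
      obtain ⟨g, hg⟩ := c2 k
      refine ⟨g, Subtype.ext (Subtype.ext (IsometryEquiv.ext fun y => φ.symm.injective ?_))⟩
      rw [hg, ← φ.injective.eq_iff, φ.apply_symm_apply, hρ, φ.apply_symm_apply]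
  have hmul : ∀ g g', ρ (g * g') = ρ g * ρ g' := by
    intro g g'
    refine Subtype.ext (Subtype.ext (IsometryEquiv.ext fun y => ?_))
    obtain ⟨x, rfl⟩ := φ.surjective y
    rw [← hρ]
    change φ (g.1.1 (g'.1.1 x)) = (ρ g).1.1 ((ρ g').1.1 (φ x))
    rw [hρ, hρ]
  exact ⟨φ, hφ, MulEquiv.ofBijective (MulHom.mk ρ hmul) hbij, hρ⟩

end EqMMSpace

/-! ### Chains of couplings and limits of kernels -/

/-- Ionescu-Tulcea for the Markov chain whose transitions disintegrate the `π n`. If the law at time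
`n` is correct, so is the law of the pair at times `n` and `n + 1`, hence the law at time `n + 1`.
-/
theorem MMSpace.exists_chain (X : ℕ → MMSpace.{u}) (π : ∀ n, Measure (X n × X (n + 1)))
    (hπ : ∀ n, π n ∈ Couplings (X n) (X (n + 1))) : ∃ P : Measure (∀ n, X n),
      IsProbabilityMeasure P ∧ ∀ n, MeasurePreserving (fun ω : ∀ n, X n => (ω n, ω (n + 1))) P (π n) := by
  have := fun n => Couplings.isProbabilityMeasure (hπ n)
  let ev : ∀ n, (∀ i : Finset.Iic n, X i) → X n := fun n x => x ⟨n, Finset.mem_Iic.2 le_rfl⟩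
  have hev : ∀ n, Measurable (ev n) := fun n => measurable_pi_apply _
  let κ : ∀ n, ProbabilityTheory.Kernel (∀ i : Finset.Iic n, X i) (X (n + 1)) :=
    fun n => (π n).condKernel.comap (ev n) (hev n)
  let P := ProbabilityTheory.Kernel.trajMeasure (X := fun n => (X n).carrier) (X 0).μ κ
  have step : ∀ n, P.map (fun ω => ω n) = (X n).μ →
      P.map (fun ω => (ω n, ω (n + 1))) = π n := by
    intro n hn
    have h1 := ProbabilityTheory.Kernel.map_frestrictLe_trajMeasure_compProd_eq_map_trajMeasure
      (X := fun n => (X n).carrier) (μ₀ := (X 0).μ) (κ := κ) (a := n)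
    have h2 := congrArg (Measure.map fun p => (ev n p.1, p.2)) h1
    rw [Measure.map_compProd_comap, Measure.map_map (by fun_prop) (by fun_prop),
      Measure.map_map (by fun_prop) (by fun_prop)] at h2
    refine Eq.trans h2.symm ?_
    change (P.map (fun ω => ω n)).compProd _ = _
    rw [hn, ← (hπ n).1]
    exact (π n).disintegrate (π n).condKernel
  have law : ∀ n, P.map (fun ω => ω n) =
      (X n).μ := by
    intro n
    induction n with
    | zero =>
      obtain ⟨s, hs, hs0, h1⟩ : ∃ s : X 0 → ∀ i : Finset.Iic 0, X i, Measurable s ∧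
          (∀ x, ev 0 (s x) = x) ∧ P.map (Preorder.frestrictLe 0) = (X 0).μ.map s := by
        refine ⟨(MeasurableEquiv.piUnique fun i : Finset.Iic 0 => (X i).carrier).symm,
          MeasurableEquiv.measurable _, fun _ => rfl, ?_⟩
        refine (Measure.map_comp _ _ (by fun_prop)).trans ?_
        rw [ProbabilityTheory.Kernel.traj_map_frestrictLe,
          ProbabilityTheory.Kernel.partialTraj_self, Measure.id_comp]
        rfl
      have h2 := congrArg (Measure.map (ev 0)) h1
      rw [Measure.map_map (hev 0) (by fun_prop), Measure.map_map (hev 0) hs,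
        show ev 0 ∘ s = id from funext hs0, Measure.map_id] at h2
      exact h2
    | succ n ih =>
      have := congrArg (Measure.map Prod.snd) (step n ih)
      rw [Measure.map_map (by fun_prop) (by fun_prop), (hπ n).2] at this
      exact this
  exact ⟨_, inferInstance, fun n => ⟨by fun_prop, step n (law n)⟩⟩

/-- `F n` converges to `f`, with error at most `r n` on `D n × D n`, where the sets `D n` increase
and exhaust the space up to measure `r n`. -/
structure IsUnifLimit {Ω : Type*} [MeasurableSpace Ω] (P : Measure Ω) (D : ℕ → Set Ω) (r : ℕ → ℝ)
    (F : ℕ → Ω → Ω → ℝ) (f : Ω → Ω → ℝ) : Prop where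
  mono : Monotone D
  measureReal_compl_le : ∀ n, P.real (D n)ᶜ ≤ r n
  tendsto_zero : Tendsto r atTop (𝓝 0)
  abs_sub_le : ∀ n, ∀ ω ∈ D n, ∀ ω' ∈ D n, |F n ω ω' - f ω ω'| ≤ r n

namespace IsUnifLimit

variable {Ω Ω' : Type*} [MeasurableSpace Ω] [MeasurableSpace Ω'] {P : Measure Ω} {D D' : ℕ → Set Ω}
  {r r' : ℕ → ℝ} {F F' : ℕ → Ω → Ω → ℝ} {f f' : Ω → Ω → ℝ}

theorem tendsto (H : IsUnifLimit P D r F f) {ω ω' : Ω} (hω : ω ∈ ⋃ n, D n)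
    (hω' : ω' ∈ ⋃ n, D n) : Tendsto (fun n => F n ω ω') atTop (𝓝 (f ω ω')) := by
  obtain ⟨n, hn⟩ := mem_iUnion.1 hω
  obtain ⟨m, hm⟩ := mem_iUnion.1 hω'
  refine tendsto_iff_dist_tendsto_zero.2 (squeeze_zero' (.of_forall fun _ => dist_nonneg) ?_
    H.tendsto_zero)
  filter_upwards [eventually_ge_atTop n, eventually_ge_atTop m] with k hk hk'
  exact H.abs_sub_le k ω (H.mono hk hn) ω' (H.mono hk' hm)

theorem measure_compl_iUnion [IsFiniteMeasure P] (H : IsUnifLimit P D r F f) :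
    P (⋃ n, D n)ᶜ = 0 := by
  rw [← measureReal_eq_zero_iff]
  refine le_antisymm (ge_of_tendsto' H.tendsto_zero fun n => ?_) measureReal_nonneg
  exact (measureReal_mono (compl_subset_compl.2 (subset_iUnion D n))).trans
    (H.measureReal_compl_le n)

theorem comp [IsFiniteMeasure P] (H : IsUnifLimit P D r F f) {P' : Measure Ω'} {j : Ω' → Ω}
    (hj : MeasurePreserving j P' P) : IsUnifLimit P' (fun n => j ⁻¹' D n) r
      (fun n x y => F n (j x) (j y)) fun x y => f (j x) (j y) where
  mono := fun _ _ h => preimage_mono (H.mono h)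
  measureReal_compl_le := fun n => by
    refine le_trans (ENNReal.toReal_mono (measure_ne_top _ _) ?_) (H.measureReal_compl_le n)
    rw [← preimage_compl]
    exact (Measure.le_map_apply hj.measurable.aemeasurable _).trans (by rw [hj.map_eq])
  tendsto_zero := H.tendsto_zero
  abs_sub_le := fun n x hx y hy => H.abs_sub_le n _ hx _ hy

/-- Two uniform limits, on a common sequence of sets and with a common error. -/
theorem inter [IsFiniteMeasure P] (H : IsUnifLimit P D r F f) (H' : IsUnifLimit P D' r' F' f') :
    IsUnifLimit P (fun n => D n ∩ D' n) (r + r') F f ∧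
      IsUnifLimit P (fun n => D n ∩ D' n) (r + r') F' f' := by
  have h0 : ∀ n, 0 ≤ r n := fun n => measureReal_nonneg.trans (H.measureReal_compl_le n)
  have h0' : ∀ n, 0 ≤ r' n := fun n => measureReal_nonneg.trans (H'.measureReal_compl_le n)
  have h1 : Monotone fun n => D n ∩ D' n := fun _ _ h => inter_subset_inter (H.mono h) (H'.mono h)
  have h2 : ∀ n, P.real (D n ∩ D' n)ᶜ ≤ (r + r') n := fun n => by
    rw [compl_inter]
    exact (measureReal_union_le _ _).trans
      (add_le_add (H.measureReal_compl_le n) (H'.measureReal_compl_le n))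
  have h3 : Tendsto (r + r') atTop (𝓝 0) := by
    have := H.tendsto_zero.add H'.tendsto_zero
    rwa [add_zero] at this
  exact ⟨⟨h1, h2, h3, fun n x hx y hy => (H.abs_sub_le n x hx.1 y hy.1).trans
      (le_add_of_nonneg_right (h0' n))⟩, ⟨h1, h2, h3, fun n x hx y hy =>
      (H'.abs_sub_le n x hx.2 y hy.2).trans (le_add_of_nonneg_left (h0 n))⟩⟩

end IsUnifLimit

/-- A Borel-Cantelli argument: the tail sum of `e` bounds both the measure lost by intersecting the
later good sets and the telescoping error on that intersection. -/
theorem exists_isUnifLimit {Ω : Type*} [MeasurableSpace Ω] {P : Measure Ω} [IsFiniteMeasure P]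
    {e : ℕ → ℝ} (he : Summable e) {F : ℕ → Ω → Ω → ℝ} {E : ℕ → Set Ω}
    (hE : ∀ n, P.real (E n)ᶜ ≤ e n)
    (H : ∀ n, ∀ ω ∈ E n, ∀ ω' ∈ E n, |F n ω ω' - F (n + 1) ω ω'| ≤ e n) :
    ∃ f, IsUnifLimit P (fun n => ⋂ k, E (k + n)) (fun n => ∑' k, e (k + n)) F f := by
  have he0 : ∀ n, 0 ≤ e n := fun n => measureReal_nonneg.trans (hE n)
  have hen : ∀ n, Summable fun k => e (k + n) := fun n => (summable_nat_add_iff n).2 he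
  -- Where the kernels diverge the value of `limUnder` is arbitrary; no such pair lies in any of the
  -- products of the good sets.
  refine ⟨fun ω ω' => limUnder atTop fun n => F n ω ω', ⟨?_, ?_, tendsto_sum_nat_add e, ?_⟩⟩
  · intro n m hnm ω hω
    refine mem_iInter.2 fun k => ?_
    have := mem_iInter.1 hω (k + (m - n))
    rwa [show k + (m - n) + n = k + m by omega] at this
  · intro n
    rw [compl_iInter]
    refine ENNReal.toReal_le_of_le_ofReal (tsum_nonneg fun k => he0 _)
      ((measure_iUnion_le _).trans ?_)
    rw [ENNReal.ofReal_tsum_of_nonneg (fun k => he0 _) (hen n)]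
    exact ENNReal.tsum_le_tsum fun k =>
      (ENNReal.le_ofReal_iff_toReal_le (measure_ne_top _ _) (he0 _)).2 (hE _)
  · intro n ω hω ω' hω'
    have hd : ∀ k, dist (F (k + n) ω ω') (F (k.succ + n) ω ω') ≤ e (k + n) := fun k => by
      have := H (k + n) ω (mem_iInter.1 hω k) ω' (mem_iInter.1 hω' k)
      rwa [← Real.dist_eq, show k + n + 1 = k.succ + n by omega] at this
    have hc := cauchySeq_of_dist_le_of_summable _ hd (hen n)
    obtain ⟨x, hx⟩ := cauchySeq_tendsto_of_complete hc
    have hx' : Tendsto (fun n => F n ω ω') atTop (𝓝 x) := (tendsto_add_atTop_iff_nat n).1 hx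
    have := dist_le_tsum_of_dist_le_of_tendsto₀ _ hd (hen n) hx
    rw [hx'.limUnder_eq, ← Real.dist_eq]
    simpa using this

/-! ### The limit mm-space -/

/-- The limit space inherits its σ-algebra from the probability space, not from the limit metric.
Balls are measurable, and open sets are countable unions of balls. -/
theorem opensMeasurableSpace_of_measurable_dist {T : Type*} [MeasurableSpace T]
    [PseudoMetricSpace T] [SecondCountableTopology T]
    (h : ∀ t : T, Measurable fun s => dist s t) : OpensMeasurableSpace T := by
  refine ⟨MeasurableSpace.generateFrom_le fun U (hU : IsOpen U) => ?_⟩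
  choose r hr hrU using Metric.isOpen_iff.1 hU
  have hUeq : U = ⋃ x : U, Metric.ball x.1 (r x.1 x.2) :=
    Subset.antisymm (fun x hx => mem_iUnion.2 ⟨⟨x, hx⟩, Metric.mem_ball_self (hr x hx)⟩)
      (iUnion_subset fun x => hrU x.1 x.2)
  obtain ⟨C, hC, hCU⟩ := TopologicalSpace.isOpen_iUnion_countable
    (fun x : U => Metric.ball x.1 (r x.1 x.2)) fun x => Metric.isOpen_ball
  rw [hUeq, ← hCU]
  exact MeasurableSet.biUnion hC fun x _ => measurableSet_lt (h _) measurable_const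

theorem measurePreserving_subtype_val {T : Type*} [MeasurableSpace T] {P : Measure T} {s : Set T}
    (hs : MeasurableSet s) (h : P sᶜ = 0) :
    MeasurePreserving (Subtype.val : s → T) (P.comap Subtype.val) P :=
  ⟨measurable_subtype_coe, (map_comap_subtype_coe hs P).trans
    (Measure.restrict_eq_self_of_ae_mem h)⟩

theorem MeasureTheory.MeasurePreserving.isProbabilityMeasure_source {S T : Type*}
    [MeasurableSpace S] [MeasurableSpace T] {P' : Measure S} {P : Measure T}
    [IsProbabilityMeasure P] {j : S → T} (hj : MeasurePreserving j P' P) :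
    IsProbabilityMeasure P' := by
  have : IsProbabilityMeasure (P'.map j) := by rw [hj.map_eq]; infer_instance
  exact Measure.isProbabilityMeasure_of_map j

/-- A probability measure on a separable pseudo-metric space defines an mm-space, the support of
its image in the completion. -/
theorem MMSpace.exists_of_pseudoMetricSpace {T : Type u} [MeasurableSpace T] [PseudoMetricSpace T]
    [SecondCountableTopology T] [OpensMeasurableSpace T] (P : Measure T) [IsProbabilityMeasure P] :
    ∃ (Z : MMSpace.{u}) (Ω : Type u) (_ : MeasurableSpace Ω) (P' : Measure Ω)
      (_ : IsProbabilityMeasure P') (j : Ω → T) (q : Ω → Z), MeasurePreserving j P' P ∧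
      MeasurePreserving q P' Z.μ ∧ ∀ x y, dist (q x) (q y) = dist (j x) (j y) := by
  -- The completion is Hausdorff, so it also identifies points at distance zero.
  let _ : MeasurableSpace (UniformSpace.Completion T) := borel _
  have _ : BorelSpace (UniformSpace.Completion T) := ⟨rfl⟩
  have hc : Measurable ((↑) : T → UniformSpace.Completion T) :=
    (UniformSpace.Completion.continuous_coe T).measurable
  have _ : SecondCountableTopology (UniformSpace.Completion T) :=
    UniformSpace.secondCountable_of_separable _
  let ν : Measure (UniformSpace.Completion T) := P.map (↑)
  have hν : IsProbabilityMeasure ν := Measure.isProbabilityMeasure_map hc.aemeasurable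
  have hS : MeasurableSet ν.support := Measure.isClosed_support.measurableSet
  let Ω : Type u := {t : T // (t : UniformSpace.Completion T) ∈ ν.support}
  have hSΩ : MeasurableSet {t : T | (t : UniformSpace.Completion T) ∈ ν.support} := hc hS
  let P' : Measure Ω := P.comap Subtype.val
  have hfull : P {t : T | (t : UniformSpace.Completion T) ∈ ν.support}ᶜ = 0 := by
    have : ν ν.supportᶜ = 0 := Measure.measure_compl_support
    rwa [Measure.map_apply hc hS.compl] at this
  have hj : MeasurePreserving (Subtype.val : Ω → T) P' P := measurePreserving_subtype_val hSΩ hfull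
  have hP' : IsProbabilityMeasure P' := hj.isProbabilityMeasure_source
  let q : Ω → ν.support := fun t => ⟨(t.1 : UniformSpace.Completion T), t.2⟩
  have hq : Measurable q := (hc.comp measurable_subtype_coe).subtype_mk
  have hval : (P'.map q).map Subtype.val = ν := by
    rw [Measure.map_map measurable_subtype_coe hq]
    change P'.map ((↑) ∘ Subtype.val) = ν
    rw [← Measure.map_map hc measurable_subtype_coe, hj.map_eq]
  have hcomp : CompleteSpace ν.support :=
    Measure.isClosed_support.isComplete.completeSpace_coe
  have hprob : IsProbabilityMeasure (P'.map q) := Measure.isProbabilityMeasure_map hq.aemeasurable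
  have hpos : (P'.map q).IsOpenPosMeasure := by
    refine ⟨fun U hU hne => ?_⟩
    obtain ⟨V, hV, rfl⟩ := isOpen_induced_iff.1 hU
    obtain ⟨⟨x, hx⟩, hxV⟩ := hne
    have h1 := (Measure.mem_support_iff_forall x).1 hx V (hV.mem_nhds hxV)
    rw [← hval, Measure.map_apply measurable_subtype_coe hV.measurableSet] at h1
    exact h1.ne'
  exact ⟨{ carrier := ν.support, μ := P'.map q }, Ω, inferInstance, P', hP', Subtype.val, q, hj,
    ⟨hq, rfl⟩, fun x y => UniformSpace.Completion.dist_eq _ _⟩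

/-- The limit space of a sequence of mm-spaces whose metrics, read on a common probability space,
converge uniformly up to small measure. -/
theorem MMSpace.exists_limit {X : ℕ → MMSpace.{u}} {Ω : Type u} [MeasurableSpace Ω]
    {P : Measure Ω} [IsProbabilityMeasure P] {a : ∀ n, Ω → X n} (ha : ∀ n, Measurable (a n))
    {D : ℕ → Set Ω} (hD : ∀ n, MeasurableSet (D n)) {r : ℕ → ℝ} {ρ : Ω → Ω → ℝ}
    (H : IsUnifLimit P D r (fun n ω ω' => dist (a n ω) (a n ω')) ρ) :
    ∃ (Z : MMSpace.{u}) (Ω' : Type u) (_ : MeasurableSpace Ω') (P' : Measure Ω')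
      (_ : IsProbabilityMeasure P') (j : Ω' → Ω) (q : Ω' → Z), MeasurePreserving j P' P ∧
      MeasurePreserving q P' Z.μ ∧ ∀ x y, dist (q x) (q y) = ρ (j x) (j y) := by
  let T : Type u := {ω // ω ∈ ⋃ n, D n}
  have hT : MeasurableSet (⋃ n, D n) := .iUnion hD
  have lim : ∀ s t : T, Tendsto (fun n => dist (a n s.1) (a n t.1)) atTop (𝓝 (ρ s.1 t.1)) :=
    fun s t => H.tendsto s.2 t.2
  let _ : PseudoMetricSpace T :=
    { dist := fun s t => ρ s.1 t.1
      dist_self := fun s => tendsto_nhds_unique (lim s s) (by simp)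
      dist_comm := fun s t => tendsto_nhds_unique (lim s t) (by simpa only [dist_comm] using lim t s)
      dist_triangle := fun s t v => le_of_tendsto_of_tendsto' (lim s v) ((lim s t).add (lim t v))
        fun n => dist_triangle _ _ _ }
  have hdist : ∀ s t : T, dist s t = ρ s.1 t.1 := fun _ _ => rfl
  have hmeas : ∀ t : T, Measurable fun s => dist s t := fun t =>
    measurable_of_tendsto_metrizable (f := fun n (s : T) => dist (a n s.1) (a n t.1))
      (fun n => ((ha n).comp measurable_subtype_coe).dist measurable_const)
      (tendsto_pi_nhds.2 fun s => lim s t)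
  have hsec : SecondCountableTopology T := by
    refine Metric.secondCountable_of_almost_dense_set fun ε hε => ?_
    obtain ⟨n₀, hn₀⟩ := (H.tendsto_zero.eventually (gt_mem_nhds (half_pos hε))).exists_forall_of_atTop
    -- On `D n` with `r n < ε / 2`, a countable `ε / 2`-net for the metric of `X n` is an `ε`-net
    -- for `ρ`.
    have hcount : ∀ n, ∃ C : Set T, C.Countable ∧ ∀ t : T, t.1 ∈ D n → ∃ c ∈ C,
        c.1 ∈ D n ∧ dist (a n t.1) (a n c.1) < ε / 2 := by
      intro n
      let f : {t : T // t.1 ∈ D n} → X n := fun t => a n t.1.1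
      obtain ⟨C, hC, hCd⟩ := TopologicalSpace.exists_countable_dense (range f)
      choose g hg using fun y : range f => y.2
      refine ⟨(fun y => (g y).1) '' C, hC.image _, fun t ht => ?_⟩
      obtain ⟨y, hy, hyC⟩ := hCd.exists_dist_lt ⟨f ⟨t, ht⟩, ⟨t, ht⟩, rfl⟩ (half_pos hε)
      refine ⟨_, mem_image_of_mem _ hy, (g y).2, ?_⟩
      have h1 : a n (g y).1.1 = y := hg y
      rw [h1]
      exact hyC
    choose C hC hCd using hcount
    refine ⟨⋃ n, C n, countable_iUnion hC, fun t => ?_⟩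
    obtain ⟨m, hm⟩ := mem_iUnion.1 t.2
    obtain ⟨c, hc, hcD, hdc⟩ := hCd (max m n₀) t (H.mono (le_max_left _ _) hm)
    refine ⟨c, mem_iUnion.2 ⟨_, hc⟩, ?_⟩
    have h1 := H.abs_sub_le _ t.1 (H.mono (le_max_left _ n₀) hm) c.1 hcD
    rw [hdist]
    linarith [(abs_le.1 h1).1, hn₀ _ (le_max_right m n₀)]
  have hopen := opensMeasurableSpace_of_measurable_dist hmeas
  let P₁ : Measure T := P.comap Subtype.val
  have hj : MeasurePreserving (Subtype.val : T → Ω) P₁ P :=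
    measurePreserving_subtype_val hT H.measure_compl_iUnion
  have hP₁ : IsProbabilityMeasure P₁ := hj.isProbabilityMeasure_source
  obtain ⟨Z, Ω', m', P', h', j, q, hj', hq, hd⟩ := MMSpace.exists_of_pseudoMetricSpace P₁
  exact ⟨Z, Ω', m', P', h', Subtype.val ∘ j, q, hj.comp hj', hq, hd⟩

/-! ### Limits of automorphisms -/

namespace MMSpace

variable {Z : MMSpace.{u}} {X : ℕ → MMSpace.{u}} {Ω : Type*} [MeasurableSpace Ω] 
  {a : ∀ n, Ω → X n} {q : Ω → Z} {D : ℕ → Set Ω} {r : ℕ → ℝ}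
  {f : Ω → Ω → ℝ} {g : ∀ n, (X n).Aut}

theorem dense_image_of_measure_compl_eq_zero {P : Measure Ω} (hq : MeasurePreserving q P Z.μ) {T : Set Ω}
    (hT : P Tᶜ = 0) : Dense (q '' T) := by
  refine dense_iff_inter_open.2 fun U hU hne => ?_
  by_contra hcon
  have h1 : q ⁻¹' U ⊆ Tᶜ := fun ω hω hωT => hcon ⟨q ω, hω, ω, hωT, rfl⟩
  have h2 := measure_mono_null h1 hT
  rw [hq.measure_preimage hU.measurableSet.nullMeasurableSet] at h2
  exact (hU.measure_pos Z.μ hne).ne' h2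

variable {P : Measure Ω} [IsProbabilityMeasure P]

/-- A limit of measure preserving isometries, read on a common probability space, takes values
close to points of the space. -/
theorem exists_limit_le (ha : ∀ n, MeasurePreserving (a n) P (X n).μ)
    (hq : MeasurePreserving q P Z.μ)
    (H : IsUnifLimit P D r (fun n ω ω' => dist (a n ω) (a n ω')) fun ω ω' => dist (q ω) (q ω'))
    (Hg : IsUnifLimit P D r (fun n ω ω' => dist ((g n).1 (a n ω)) (a n ω')) f)
    {ω : Ω} (hω : ω ∈ ⋃ n, D n) {δ : ℝ} (hδ : 0 < δ) : ∃ ω' ∈ ⋃ n, D n, f ω ω' ≤ δ := by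
  obtain ⟨m, hm⟩ := mem_iUnion.1 hω
  have hc : 0 < Z.μ.real (Metric.ball (q ω) (δ / 3)) :=
    ENNReal.toReal_pos (Metric.measure_ball_pos _ _ (by positivity)).ne' (measure_ne_top _ _)
  set c := Z.μ.real (Metric.ball (q ω) (δ / 3))
  obtain ⟨n, hn, hmn⟩ := ((H.tendsto_zero.eventually
    (gt_mem_nhds (show 0 < min (c / 3) (δ / 3) by positivity))).and (eventually_ge_atTop m)).exists
  have hωn := H.mono hmn hm
  have hnc := hn.trans_le (min_le_left _ _)
  have hnδ := hn.trans_le (min_le_right _ _)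
  -- Up to `r n`, the `δ / 3`-ball of `Z` sits inside the `2δ / 3`-ball of `X n`, so the latter is
  -- heavier than the complement of `D n`.
  have h1 : c ≤ (X n).μ.real (Metric.ball (a n ω) (2 * (δ / 3))) + r n := by
    rw [← (ha n).measureReal_preimage Metric.isOpen_ball.measurableSet.nullMeasurableSet,
      ← show P.real (q ⁻¹' Metric.ball (q ω) (δ / 3)) = c from
        hq.measureReal_preimage Metric.isOpen_ball.measurableSet.nullMeasurableSet]
    have hsub : q ⁻¹' Metric.ball (q ω) (δ / 3) ⊆
        a n ⁻¹' Metric.ball (a n ω) (2 * (δ / 3)) ∪ (D n)ᶜ := by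
      intro ω' hω'
      by_cases hD : ω' ∈ D n
      · refine Or.inl ?_
        have h2 := H.abs_sub_le n ω' hD ω hωn
        rw [mem_preimage, Metric.mem_ball] at hω' ⊢
        linarith [(abs_le.1 h2).2]
      · exact Or.inr hD
    exact (measureReal_mono hsub).trans ((measureReal_union_le _ _).trans
      (by linarith [H.measureReal_compl_le n]))
  obtain ⟨ω', hω', hd⟩ := exists_mem_dist_lt (ha n) (g n) (H.measureReal_compl_le n)
    (ω := ω) (r := 2 * (δ / 3)) (by linarith)
  refine ⟨ω', mem_iUnion.2 ⟨n, hω'⟩, ?_⟩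
  have h2 := Hg.abs_sub_le n ω hωn ω' hω'
  rw [dist_comm] at hd
  linarith [(abs_le.1 h2).1]

/-- A limit of measure preserving isometries, read on a common probability space, is realized by a
measure preserving isometric embedding of the limit space. -/
theorem exists_isometry_limit (ha : ∀ n, MeasurePreserving (a n) P (X n).μ)
    (hq : MeasurePreserving q P Z.μ)
    (H : IsUnifLimit P D r (fun n ω ω' => dist (a n ω) (a n ω')) fun ω ω' => dist (q ω) (q ω'))
    (Hg : IsUnifLimit P D r (fun n ω ω' => dist ((g n).1 (a n ω)) (a n ω')) f) :
    ∃ k : Z → Z, Isometry k ∧ MeasurePreserving k Z.μ Z.μ ∧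
      ∀ ω ∈ ⋃ n, D n, ∀ ω' ∈ ⋃ n, D n, f ω ω' = dist (k (q ω)) (q ω') := by
  -- These inequalities say that `f ω` acts as the distance from a virtual point, the future `k (q
  -- ω)`; `tri3` records that the `g n` are isometries.
  have tri1 : ∀ ω ∈ ⋃ n, D n, ∀ ω₁ ∈ ⋃ n, D n, ∀ ω₂ ∈ ⋃ n, D n,
      f ω ω₁ ≤ f ω ω₂ + dist (q ω₂) (q ω₁) := fun ω hω ω₁ h1 ω₂ h2 =>
    le_of_tendsto_of_tendsto' (Hg.tendsto hω h1) ((Hg.tendsto hω h2).add (H.tendsto h2 h1))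
      fun n => dist_triangle _ _ _
  have tri2 : ∀ ω ∈ ⋃ n, D n, ∀ ω₁ ∈ ⋃ n, D n, ∀ ω₂ ∈ ⋃ n, D n,
      dist (q ω₁) (q ω₂) ≤ f ω ω₁ + f ω ω₂ := fun ω hω ω₁ h1 ω₂ h2 =>
    le_of_tendsto_of_tendsto' (H.tendsto h1 h2) ((Hg.tendsto hω h1).add (Hg.tendsto hω h2))
      fun n => dist_triangle_left _ _ _
  have tri3 : ∀ ω₁ ∈ ⋃ n, D n, ∀ ω₂ ∈ ⋃ n, D n, ∀ ω ∈ ⋃ n, D n,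
      |f ω₁ ω - dist (q ω₁) (q ω₂)| ≤ f ω₂ ω := fun ω₁ h1 ω₂ h2 ω hω =>
    le_of_tendsto_of_tendsto' ((Hg.tendsto h1 hω).sub (H.tendsto h1 h2)).abs (Hg.tendsto h2 hω)
      fun n => by
        rw [← (g n).1.dist_eq (a n ω₁), dist_comm _ (a n ω), dist_comm _ ((g n).1 (a n ω₂)),
          dist_comm ((g n).1 (a n ω₂)) (a n ω)]
        exact abs_dist_sub_le _ _ _
  have near := fun ω hω δ hδ => exists_limit_le ha hq H Hg (ω := ω) hω (δ := δ) hδ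
  have point : ∀ ω ∈ ⋃ n, D n, ∃ z : Z, ∀ ω' ∈ ⋃ n, D n, f ω ω' = dist z (q ω') := by
    intro ω hω
    -- The virtual point is a limit of actual points `q (s n)`, so completeness of `Z` supplies it.
    choose s hs hsf using fun n : ℕ => near ω hω (1 / ((n : ℝ) + 1)) Nat.one_div_pos_of_nat
    have hs0 : Tendsto (fun n => f ω (s n)) atTop (𝓝 0) := by
      refine squeeze_zero (fun n => ?_) hsf tendsto_one_div_add_atTop_nhds_zero_nat
      linarith [tri2 ω hω _ (hs n) _ (hs n), dist_self (q (s n))]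
    have hcauchy : CauchySeq fun n => q (s n) := by
      refine cauchySeq_of_le_tendsto_0 (fun n : ℕ => 2 * (1 / ((n : ℝ) + 1))) (fun n m N hn hm => ?_)
        (by simpa using tendsto_one_div_add_atTop_nhds_zero_nat.const_mul (2 : ℝ))
      have h1 := (hsf n).trans (Nat.one_div_le_one_div hn)
      have h2 := (hsf m).trans (Nat.one_div_le_one_div hm)
      linarith [tri2 ω hω _ (hs n) _ (hs m)]
    obtain ⟨z, hz⟩ := cauchySeq_tendsto_of_complete hcauchy
    refine ⟨z, fun ω' hω' => tendsto_nhds_unique ?_ (hz.dist tendsto_const_nhds)⟩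
    refine tendsto_iff_dist_tendsto_zero.2 (squeeze_zero (fun _ => dist_nonneg) (fun n => ?_) hs0)
    rw [Real.dist_eq, abs_le]
    constructor
    · linarith [tri1 ω hω ω' hω' _ (hs n)]
    · linarith [tri2 ω hω _ (hs n) ω' hω']
  choose! k₀ hk₀ using point
  have isom : ∀ ω₁ ∈ ⋃ n, D n, ∀ ω₂ ∈ ⋃ n, D n,
      dist (q ω₁) (q ω₂) = dist (k₀ ω₁) (k₀ ω₂) := by
    intro ω₁ h1 ω₂ h2
    rw [← sub_eq_zero, ← abs_eq_zero]
    refine le_antisymm (le_of_forall_pos_le_add fun δ hδ => ?_) (abs_nonneg _)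
    obtain ⟨ω, hω, hωδ⟩ := near ω₂ h2 (δ / 2) (half_pos hδ)
    have e1 := tri3 ω₁ h1 ω₂ h2 ω hω
    have e2 := abs_dist_sub_le (k₀ ω₂) (q ω) (k₀ ω₁)
    rw [← hk₀ ω₂ h2 ω hω, dist_comm (q ω), ← hk₀ ω₁ h1 ω hω, dist_comm (k₀ ω₂)] at e2
    rw [abs_le] at e1 e2 ⊢
    constructor <;> linarith [e1.1, e1.2, e2.1, e2.2]
  have hdense := dense_image_of_measure_compl_eq_zero hq H.measure_compl_iUnion
  -- The first projection is dense, which suffices to extend `k₀` to `Z`; surjectivity is not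
  -- available yet.
  let R : Set (Z × Z) := closure ((fun ω => (q ω, k₀ ω)) '' ⋃ n, D n)
  have hRd : ∀ p ∈ R, ∀ p' ∈ R, dist p.1 p'.1 = dist p.2 p'.2 := by
    have key : R ×ˢ R ⊆ {s : (Z × Z) × (Z × Z) | dist s.1.1 s.2.1 = dist s.1.2 s.2.2} := by
      rw [← closure_prod_eq]
      refine closure_minimal ?_ (isClosed_eq (by fun_prop) (by fun_prop))
      rintro ⟨-, -⟩ ⟨⟨ω, hω, rfl⟩, ⟨ω', hω', rfl⟩⟩
      exact isom ω hω ω' hω'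
    exact fun p hp p' hp' => key (mk_mem_prod hp hp')
  have hRX : ∀ x : Z, ∀ δ > 0, ∃ p ∈ R, dist p.1 x ≤ δ := by
    intro x δ hδ
    obtain ⟨-, ⟨ω, hω, rfl⟩, h⟩ := hdense.exists_dist_lt x hδ
    exact ⟨_, subset_closure ⟨ω, hω, rfl⟩, by rw [dist_comm]; exact h.le⟩
  choose k hk using exists_mem_of_isometric_relation isClosed_closure hRd hRX
  have hkiso : Isometry k := Isometry.of_dist_eq fun x y => (hRd _ (hk x) _ (hk y)).symm
  have hkq : ∀ ω ∈ ⋃ n, D n, k (q ω) = k₀ ω := fun ω hω => by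
    rw [← dist_eq_zero]
    exact (hRd _ (hk (q ω)) (q ω, k₀ ω) (subset_closure ⟨ω, hω, rfl⟩)).symm.trans (dist_self _)
  have hfk : ∀ ω ∈ ⋃ n, D n, ∀ ω' ∈ ⋃ n, D n, f ω ω' = dist (k (q ω)) (q ω') :=
    fun ω hω ω' hω' => by rw [hkq ω hω, hk₀ ω hω ω' hω']
  refine ⟨k, hkiso, measurePreserving_of_forall_isClosed hkiso.continuous.measurable
    fun K hK => ?_, hfk⟩
  rw [← ENNReal.toReal_le_toReal (measure_ne_top _ _) (measure_ne_top _ _)]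
  change Z.μ.real _ ≤ Z.μ.real _
  have bound : ∀ n : ℕ, Z.μ.real (k ⁻¹' K) ≤
      Z.μ.real (Metric.cthickening (1 / ((n : ℝ) + 1) + r n) K) + (r n + r n) := by
    intro n
    let A := D n ∩ q ⁻¹' (k ⁻¹' K)
    -- The measure is compared inside `X n`, where `g n` preserves it. Thickening makes the image of
    -- `A` open, hence measurable.
    let B := Metric.thickening (1 / ((n : ℝ) + 1)) ((fun ω => (g n).1 (a n ω)) '' A)
    have hB : MeasurableSet B := Metric.isOpen_thickening.measurableSet
    have hg : MeasurePreserving (g n).1 (X n).μ (X n).μ := (g n).2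
    have h1 : Z.μ.real (k ⁻¹' K) ≤ P.real A + r n := by
      rw [← hq.measureReal_preimage
        (hkiso.continuous.measurable hK.measurableSet).nullMeasurableSet]
      refine (measureReal_mono (fun ω hω => ?_ : _ ⊆ A ∪ (D n)ᶜ)).trans
        ((measureReal_union_le _ _).trans (by linarith [H.measureReal_compl_le n]))
      by_cases hD : ω ∈ D n
      · exact Or.inl ⟨hD, hω⟩
      · exact Or.inr hD
    have h2 : P.real A ≤ P.real (a n ⁻¹' B) := by
      rw [(ha n).measureReal_preimage hB.nullMeasurableSet,
        ← hg.measureReal_preimage hB.nullMeasurableSet,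
        ← (ha n).measureReal_preimage (hg.measurable hB).nullMeasurableSet]
      exact measureReal_mono fun ω hω =>
        Metric.self_subset_thickening Nat.one_div_pos_of_nat _ ⟨ω, hω, rfl⟩
    have h3 : P.real (a n ⁻¹' B) ≤
        Z.μ.real (Metric.cthickening (1 / ((n : ℝ) + 1) + r n) K) + r n := by
      rw [← hq.measureReal_preimage Metric.isClosed_cthickening.measurableSet.nullMeasurableSet]
      refine (measureReal_mono (fun ω hω => ?_ : _ ⊆
        q ⁻¹' Metric.cthickening (1 / ((n : ℝ) + 1) + r n) K ∪ (D n)ᶜ)).trans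
        ((measureReal_union_le _ _).trans (by linarith [H.measureReal_compl_le n]))
      by_cases hD : ω ∈ D n
      · left
        obtain ⟨-, ⟨ω', hω', rfl⟩, hd⟩ := Metric.mem_thickening_iff.1 hω
        refine Metric.mem_cthickening_of_dist_le _ (k (q ω')) _ _ hω'.2 ?_
        have h4 := Hg.abs_sub_le n ω' hω'.1 ω hD
        rw [dist_comm] at hd
        rw [dist_comm, ← hfk ω' (mem_iUnion.2 ⟨n, hω'.1⟩) ω (mem_iUnion.2 ⟨n, hD⟩)]
        linarith [(abs_le.1 h4).1]
      · exact Or.inr hD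
    linarith
  have hr0 : Tendsto (fun n : ℕ => 1 / ((n : ℝ) + 1) + r n) atTop (𝓝 0) := by
    simpa using tendsto_one_div_add_atTop_nhds_zero_nat.add H.tendsto_zero
  have hlim := ((ENNReal.continuousAt_toReal (measure_ne_top Z.μ K)).tendsto.comp
    ((tendsto_measure_cthickening_of_isClosed ⟨1, one_pos, measure_ne_top _ _⟩ hK).comp hr0)).add
    (H.tendsto_zero.add H.tendsto_zero)
  rw [add_zero, add_zero] at hlim
  exact ge_of_tendsto' hlim bound

/-- The limit `k` might fail to be onto. The kernels of the inverses are the transposes, with a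
limit `k'` adjoint to `k`: `dist (k x) y = dist (k' y) x`. Taking `x = k' y` gives `k (k' y) = y`.
-/
theorem exists_aut_limit (ha : ∀ n, MeasurePreserving (a n) P (X n).μ)
    (hq : MeasurePreserving q P Z.μ)
    (H : IsUnifLimit P D r (fun n ω ω' => dist (a n ω) (a n ω')) fun ω ω' => dist (q ω) (q ω'))
    (Hg : IsUnifLimit P D r (fun n ω ω' => dist ((g n).1 (a n ω)) (a n ω')) f) :
    ∃ k : Z.Aut, ∀ ω ∈ ⋃ n, D n, ∀ ω' ∈ ⋃ n, D n, f ω ω' = dist (k.1 (q ω)) (q ω') := by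
  obtain ⟨k, hk, hkm, hkf⟩ := exists_isometry_limit ha hq H Hg
  have Hg' : IsUnifLimit P D r (fun n ω ω' => dist ((g n)⁻¹.1 (a n ω)) (a n ω'))
      fun ω ω' => f ω' ω := by
    refine ⟨Hg.mono, Hg.measureReal_compl_le, Hg.tendsto_zero, fun n ω hω ω' hω' => ?_⟩
    rw [Aut.dist_inv_apply]
    exact Hg.abs_sub_le n ω' hω' ω hω
  obtain ⟨k', hk', -, hkf'⟩ := exists_isometry_limit ha hq H Hg'
  have hdense := dense_image_of_measure_compl_eq_zero hq H.measure_compl_iUnion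
  have adj : (fun p : Z × Z => dist (k p.1) p.2) = fun p => dist (k' p.2) p.1 := by
    refine Continuous.ext_on (hdense.prod hdense)
      ((hk.continuous.comp continuous_fst).dist continuous_snd)
      ((hk'.continuous.comp continuous_snd).dist continuous_fst) ?_
    rintro ⟨-, -⟩ ⟨⟨ω, hω, rfl⟩, ⟨ω', hω', rfl⟩⟩
    exact (hkf ω hω ω' hω').symm.trans (hkf' ω' hω' ω hω)
  refine ⟨⟨IsometryEquiv.mk' k k' (fun y => ?_) hk, hkm⟩, hkf⟩
  rw [← dist_eq_zero]
  exact (congrFun adj (k' y, y)).trans (dist_self _)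

end MMSpace

/-! ### The limit group and completeness -/

namespace MMSpace

variable {Z : MMSpace.{u}} {Ω : Type u} [MeasurableSpace Ω] {P : Measure Ω}

theorem isNear_of_measureReal_le [IsProbabilityMeasure P] {q : Ω → Z}
    (hq : MeasurePreserving q P Z.μ) {g h : Z.Aut} {δ : ℝ}
    (H : Z.μ.real {x | δ ≤ dist (g.1 x) (h.1 x)} ≤ δ) : IsNear P q q g.1 h.1 δ := by
  have hm : MeasurableSet {x | δ ≤ dist (g.1 x) (h.1 x)} :=
    (isClosed_le continuous_const (g.1.continuous.dist h.1.continuous)).measurableSet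
  rw [← hq.measureReal_preimage hm.nullMeasurableSet] at H
  refine ⟨(q ⁻¹' {x | δ ≤ dist (g.1 x) (h.1 x)})ᶜ, by rwa [compl_compl], fun ω hω ω' _ => ?_⟩
  exact (abs_dist_sub_le _ _ _).trans
    (le_of_not_ge (show ¬δ ≤ dist (g.1 (q ω)) (h.1 (q ω)) from hω))

end MMSpace

theorem IsUnifLimit.isNear {Ω X Y : Type*} [MeasurableSpace Ω] [PseudoMetricSpace X]
    [PseudoMetricSpace Y] {P : Measure Ω} {D : ℕ → Set Ω} {r : ℕ → ℝ} {F : ℕ → Ω → Ω → ℝ}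
    {f : Ω → Ω → ℝ} (H : IsUnifLimit P D r F f) (n : ℕ) {a : Ω → X} {b : Ω → Y} {g : X → X}
    {h : Y → Y} (hF : ∀ ω ω', F n ω ω' = dist (g (a ω)) (a ω'))
    (hf : ∀ ω ∈ D n, ∀ ω' ∈ D n, f ω ω' = dist (h (b ω)) (b ω')) : IsNear P a b g h (r n) :=
  ⟨D n, H.measureReal_compl_le n, fun ω hω ω' hω' => by
    rw [← hF, ← hf ω hω ω' hω']
    exact H.abs_sub_le n ω hω ω' hω'⟩

theorem IsUnifLimit.shift {Ω : Type*} [MeasurableSpace Ω] {P : Measure Ω} {D : ℕ → Set Ω}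
    {r : ℕ → ℝ} {F : ℕ → Ω → Ω → ℝ} {f : Ω → Ω → ℝ} (H : IsUnifLimit P D r F f) (N : ℕ) :
    IsUnifLimit P (fun i => D (N + i)) (fun i => r (N + i)) (fun i => F (N + i)) f where
  mono := fun _ _ h => H.mono (Nat.add_le_add_left h N)
  measureReal_compl_le := fun _ => H.measureReal_compl_le _
  tendsto_zero := H.tendsto_zero.comp (tendsto_atTop_mono (fun i => Nat.le_add_left i N) tendsto_id)
  abs_sub_le := fun _ => H.abs_sub_le _

namespace EqMMSpace

variable {A : ℕ → EqMMSpace.{u}} {Z : MMSpace.{u}} {Ω : Type u} [MeasurableSpace Ω]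
  {P : Measure Ω} [IsProbabilityMeasure P] {a : ∀ n, Ω → (A n).X} {q : Ω → Z} {D : ℕ → Set Ω}
  {r : ℕ → ℝ}

/-- The limit of the groups of `A n` along the maps `a n` and `q`. -/
def limitGroup (A : ℕ → EqMMSpace.{u}) (P : Measure Ω) [IsProbabilityMeasure P]
    (a : ∀ n, Ω → (A n).X) (q : Ω → Z) (hq : MeasurePreserving q P Z.μ)
    (h₁ : ∀ ε > 0, ∀ᶠ n in atTop, IsNear P (a n) q id id ε) : Subgroup Z.Aut where
  carrier := {k | ∀ ε > 0, ∀ᶠ n in atTop, ∃ h : (A n).G, IsNear P (a n) q h.1.1 k.1 ε}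
  one_mem' := fun ε hε => (h₁ ε hε).mono fun _ H => ⟨1, H⟩
  mul_mem' := fun {k k'} hk hk' ε hε => by
    obtain ⟨δ, hδ, H⟩ := Z.exists_forall_isNear_comp hε
    filter_upwards [hk δ hδ, hk' δ hδ] with n ⟨h, hh⟩ ⟨h', hh'⟩
    exact ⟨h * h', (H hq hh.symm hh'.symm).symm⟩
  inv_mem' := fun {k} hk ε hε => (hk ε hε).mono fun _ ⟨h, hh⟩ => ⟨h⁻¹, MMSpace.isNear_inv hh⟩

theorem isClosedSubgroup_limitGroup (hq : MeasurePreserving q P Z.μ)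
    (h₁ : ∀ ε > 0, ∀ᶠ n in atTop, IsNear P (a n) q id id ε) :
    Z.IsClosedSubgroup (limitGroup A P a q hq h₁) := by
  intro g h hg hgh ε hε
  have h2 := (tendstoInMeasure_iff_measureReal_dist.1 hgh (ε / 2) (half_pos hε)).eventually
    (gt_mem_nhds (half_pos hε))
  obtain ⟨m, hm⟩ := h2.exists
  filter_upwards [hg m (ε / 2) (half_pos hε)] with n ⟨k, hk⟩
  have := hk.trans (MMSpace.isNear_of_measureReal_le hq hm.le)
  rw [add_halves] at this
  exact ⟨k, this⟩

/-- The error is the exact partial geometric sum; the bound `2 * (1 / 2) ^ N` alone would not pass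
through the induction. -/
theorem hausNear_add (hA : ∀ n, HausNear (A n) (A (n + 1)) P (a n) (a (n + 1)) ((1 / 2) ^ n))
    (N i : ℕ) : HausNear (A N) (A (N + i)) P (a N) (a (N + i))
      (2 * (1 / 2) ^ N - 2 * (1 / 2) ^ (N + i)) := by
  induction i with
  | zero =>
    simp only [add_zero, sub_self]
    exact ⟨fun g => ⟨g, isNear_self le_rfl⟩, fun g => ⟨g, isNear_self le_rfl⟩⟩
  | succ i ih =>
    refine (ih.trans (hA (N + i))).mono (le_of_eq ?_)
    rw [← add_assoc, pow_succ _ (N + i)]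
    ring

/-- Starting from `g`, take a partner in each successive group. The errors are summable, so the
kernels converge to that of an automorphism `k`, and the chosen partners witness that `k` lies in
the limit group. -/
theorem exists_mem_limitGroup (ha : ∀ n, MeasurePreserving (a n) P (A n).X.μ)
    (hq : MeasurePreserving q P Z.μ)
    (H : IsUnifLimit P D r (fun n ω ω' => dist (a n ω) (a n ω')) fun ω ω' => dist (q ω) (q ω'))
    (h₁ : ∀ ε > 0, ∀ᶠ n in atTop, IsNear P (a n) q id id ε)
    (hA : ∀ n, HausNear (A n) (A (n + 1)) P (a n) (a (n + 1)) ((1 / 2) ^ n))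
    (N : ℕ) (g : (A N).G) : ∃ k ∈ limitGroup A P a q hq h₁,
      IsNear P (a N) q g.1.1 k.1 (r N + 2 * (1 / 2) ^ N) := by
  choose next hnext using fun n => (hA n).1
  let s : ∀ i, (A (N + i)).G := fun i => Nat.rec g (fun i h => next (N + i) h) i
  choose E hE hEs using fun i => hnext (N + i) (s i)
  have hsum : Summable fun i => (1 / 2 : ℝ) ^ (N + i) := by
    simp only [pow_add]
    exact summable_geometric_two.mul_left _
  obtain ⟨f, hf⟩ := exists_isUnifLimit (P := P) hsum (E := E)
    (F := fun i ω ω' => dist ((s i).1.1 (a (N + i) ω)) (a (N + i) ω')) hE hEs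
  obtain ⟨H1, H2⟩ := (H.shift N).inter hf
  obtain ⟨k, hk⟩ := MMSpace.exists_aut_limit (X := fun i => (A (N + i)).X)
    (a := fun i => a (N + i)) (g := fun i => (s i).1) (fun i => ha _) hq H1 H2
  have near := fun i => H2.isNear i (a := a (N + i)) (b := q) (g := (s i).1.1) (h := k.1)
    (fun _ _ => rfl) fun ω hω ω' hω' => hk ω (mem_iUnion.2 ⟨i, hω⟩) ω' (mem_iUnion.2 ⟨i, hω'⟩)
  refine ⟨k, fun ε hε => ?_, (near 0).mono ?_⟩
  · obtain ⟨i₀, hi₀⟩ := (H2.tendsto_zero.eventually (gt_mem_nhds hε)).exists_forall_of_atTop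
    filter_upwards [eventually_ge_atTop (N + i₀)] with n hn
    obtain ⟨i, rfl⟩ := Nat.exists_eq_add_of_le hn
    rw [add_assoc]
    exact ⟨s (i₀ + i), (near _).mono (hi₀ _ (Nat.le_add_right _ _)).le⟩
  · simp only [Pi.add_apply, add_zero, pow_add, pow_zero, mul_one]
    rw [tsum_mul_left, tsum_geometric_two, mul_comm]

theorem exists_tendsto_of_isUnifLimit (ha : ∀ n, MeasurePreserving (a n) P (A n).X.μ)
    (hq : MeasurePreserving q P Z.μ)
    (H : IsUnifLimit P D r (fun n ω ω' => dist (a n ω) (a n ω')) fun ω ω' => dist (q ω) (q ω'))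
    (hA : ∀ n, HausNear (A n) (A (n + 1)) P (a n) (a (n + 1)) ((1 / 2) ^ n)) :
    ∃ L : EqMMSpace.{u}, Tendsto (fun n => box (A n) L) atTop (𝓝 0) := by
  have h₁ : ∀ ε > 0, ∀ᶠ n in atTop, IsNear P (a n) q id id ε := fun ε hε =>
    (H.tendsto_zero.eventually (gt_mem_nhds hε)).mono fun n hn =>
      (H.isNear n (fun _ _ => rfl) fun _ _ _ _ => rfl).mono hn.le
  let L : EqMMSpace.{u} := ⟨Z, limitGroup A P a q hq h₁, isClosedSubgroup_limitGroup hq h₁⟩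
  have hr : ∀ n, 0 ≤ r n := fun n => measureReal_nonneg.trans (H.measureReal_compl_le n)
  have near : ∀ N, HausNear (A N) L P (a N) q (r N + 3 * (1 / 2) ^ N) := by
    intro N
    have hN : (0 : ℝ) < (1 / 2) ^ N := by positivity
    constructor
    · intro g
      obtain ⟨k, hk, hgk⟩ := exists_mem_limitGroup ha hq H h₁ hA N g
      exact ⟨⟨k, hk⟩, hgk.mono (by linarith)⟩
    · intro k
      -- Approximate `k` within `(1 / 2) ^ N` in a late group and pull back along the chain, at cost
      -- below `2 * (1 / 2) ^ N`; hence the factor `3`.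
      obtain ⟨n, ⟨h, hh⟩, hn⟩ := ((k.2 _ hN).and (eventually_ge_atTop N)).exists
      obtain ⟨i, rfl⟩ := Nat.exists_eq_add_of_le hn
      obtain ⟨g, hg⟩ := (hausNear_add hA N i).2 h
      have hi : (0 : ℝ) < (1 / 2) ^ (N + i) := by positivity
      exact ⟨g, (hg.trans hh).mono (by linarith [hr N])⟩
  refine ⟨L, tendsto_of_tendsto_of_tendsto_of_le_of_le tendsto_const_nhds ?_ (fun _ => zero_le)
    fun n => box_le_of_hausNear (B := L) (ha n) hq (near n)⟩
  have h0 : Tendsto (fun n => r n + 3 * (1 / 2 : ℝ) ^ n) atTop (𝓝 0) := by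
    simpa using H.tendsto_zero.add
      ((tendsto_pow_atTop_nhds_zero_of_lt_one (r := (1 / 2 : ℝ)) (by norm_num)
        (by norm_num)).const_mul 3)
  simpa using ENNReal.tendsto_ofReal h0

theorem exists_tendsto_of_box_lt (A : ℕ → EqMMSpace.{u})
    (h : ∀ n, box (A n) (A (n + 1)) < ENNReal.ofReal ((1 / 2) ^ n)) :
    ∃ L : EqMMSpace.{u}, Tendsto (fun n => box (A n) L) atTop (𝓝 0) := by
  choose π hπ Hπ using fun n => exists_hausNear_of_box_lt (h n)
  obtain ⟨P, hP, hPπ⟩ := MMSpace.exists_chain (fun n => (A n).X) π hπ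
  have hprob := fun n => MMSpace.Couplings.isProbabilityMeasure (hπ n)
  let a : ∀ n, (∀ n, (A n).X) → (A n).X := fun n ω => ω n
  have ha : ∀ n, MeasurePreserving (a n) P (A n).X.μ := fun n =>
    (measurePreserving_fst_of_mem (hπ n)).comp (hPπ n)
  have hA : ∀ n, HausNear (A n) (A (n + 1)) P (a n) (a (n + 1)) ((1 / 2) ^ n) := fun n =>
    (Hπ n).comp (hPπ n)
  -- Closed sets in the products make the good sets measurable, as the construction of `Z` requires.
  choose S hS hSm hSd using fun n => (hA n).isNear_id.exists_isClosed continuous_id continuous_id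
  let E : ℕ → Set (∀ n, (A n).X) := fun n => (fun ω => (a n ω, a (n + 1) ω)) ⁻¹' S n
  have hE : ∀ n, MeasurableSet (E n) := fun n =>
    ((ha n).measurable.prodMk (ha (n + 1)).measurable) (hS n).measurableSet
  obtain ⟨ρ, hρ⟩ := exists_isUnifLimit (P := P) (summable_geometric_two.mul_left 2) (E := E)
    (F := fun n ω ω' => dist (a n ω) (a n ω')) hSm fun n ω hω ω' hω' => hSd n _ hω _ hω'
  obtain ⟨Z, Ω, _, P', _, j, q, hj, hq, hd⟩ := MMSpace.exists_limit
    (fun n => (ha n).measurable) (fun n => .iInter fun k => hE (k + n)) hρ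
  have H := hρ.comp hj
  simp only [← hd] at H
  exact exists_tendsto_of_isUnifLimit (a := fun n => a n ∘ j) (fun n => (ha n).comp hj) hq H
    fun n => (hA n).comp hj

end EqMMSpace

theorem mainTheorem7 :
    ∃ m : MetricSpace XEq.{u}, (∀ p q : XEq.{u}, edist p q = XEq.box p q) ∧
      CompleteSpace XEq.{u} := by
  let _ : EMetricSpace XEq.{u} :=
    { edist := XEq.box
      edist_self := fun p => Quotient.inductionOn p EqMMSpace.box_self
      edist_comm := fun p q => Quotient.inductionOn₂ p q EqMMSpace.box_comm
      edist_triangle := fun p q s => Quotient.inductionOn₃ p q s EqMMSpace.box_triangle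
      eq_of_edist_eq_zero := fun {p q} => Quotient.inductionOn₂ p q fun _ _ h =>
        Quotient.sound (EqMMSpace.iso_of_box_eq_zero h) }
  have hfin : ∀ p q : XEq.{u}, edist p q ≠ ⊤ := fun p q => Quotient.inductionOn₂ p q fun A B =>
    ((EqMMSpace.box_le_one A B).trans_lt ENNReal.one_lt_top).ne
  refine ⟨EMetricSpace.toMetricSpace hfin, fun _ _ => rfl, ?_⟩
  -- Only sequences with distances controlled by `(1 / 2) ^ n` need a limit, and the chain of
  -- couplings uses only consecutive terms.
  refine EMetric.complete_of_convergent_controlled_sequences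
    (fun n => ENNReal.ofReal ((1 / 2) ^ n)) (fun n => by simp) fun s hs => ?_
  obtain ⟨L, hL⟩ := EqMMSpace.exists_tendsto_of_box_lt (fun n => (s n).out) fun n => by
    have := hs n n (n + 1) le_rfl (Nat.le_succ n)
    rwa [← (s n).out_eq, ← (s (n + 1)).out_eq] at this
  refine ⟨Quotient.mk _ L, tendsto_iff_edist_tendsto_0.2 ?_⟩
  refine hL.congr fun n => ?_
  conv_rhs => rw [← (s n).out_eq]
  rfl
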